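/- Let $(\mathbb{X},d)$ be a complete separable metric space with its Borel $\sigma$-algebra, and let $\nu$ be a locally finite measure on $\mathbb{X}$ such that all bounded measurable sets have finite measure. Let $\phi:\mathbb{X}^2\to[0,\infty]$ be a symmetric measurable (repulsive) potential, with the convention $e^{-\infty}=0$. Put $C_\phi=\sup_{x\in\mathbb{X}}\int_{\mathbb{X}}|1-e^{-\phi(x,y)}|\,\nu(dy)$, let $V_0=1$ and, for $k\ge 1$, $$V_k=\sup_{x_0\in\mathbb{X}}\int_{\mathbb{X}^k}\prod_{j=1}^k\Big(\exp\Big(-\sum_{i=0}^{j-2}\mathbf 1[d(x_i,x_j)<d(x_i,x_{i+1})]\,\phi(x_i,x_j)\Big)\big(1-e^{-\phi(x_{j-1},x_j)}\big)\Big)\,\nu^k(dx_1,\dots,dx_k),$$ and let $\Delta_\phi=\inf_{k\ge1}V_k^{1/k}$ (which equals $\lim_{k\to\infty}V_k^{1/k}$) be the potential-weighted connective constant. For a bounded measurable $\mathbb{V}\subseteq\mathbb{X}$ with $\nu(\mathbb{V})>0$ and $n\ge1$, let $\zeta^{(n)}_{\mathbb{V},\phi}$ be the distribution of the random graph on $[n]$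 obtained by drawing $x_1,\dots,x_n$ independently from the uniform distribution $\nu(\cdot\cap\mathbb{V})/\nu(\mathbb{V})$ and then joining each pair $i\ne j$ by an edge independently with probability $1-e^{-\phi(x_i,x_j)}$. For a finite graph $G=(W,E)$ and $z\ge0$, the hard-core model $\mu_{G,z}$ is the distribution on $\sigma\in\{0,1\}^W$ with $\mu_{G,z}(\sigma)\propto z^{|\sigma^{-1}(1)|}$ if $\sigma^{-1}(1)$ is an independent set and $\mu_{G,z}(\sigma)=0$ otherwise. For $S\subseteq W$, a boundary condition $\tau:S\to\{0,1\}$ is feasible if $\mu_{G,z}(\sigma_S=\tau)>0$; for $v\in W\setminus S$ the occupation ratio is then $R_{G,z}(v,\tau)=\mu_{G,z}(\sigma(v)=1\mid\sigma_S=\tau)/\mu_{G,z}(\sigma(v)=0\mid\sigma_S=\tau)$. We say that $\tau,\tau':S\to\{0,1\}$ differ only at distance at least $s$ from $v$ if every $u\in S$ with $\tau(u)\ne\tau'(u)$ has graph distance at least $s$ from $v$ (the distance being $\infty$ if $u$ and $v$ are not connected). The hard-core model at activity $z$ satisfies strong spatial mixing with decay rate $\delta\in[0,1)$ on a family $\mathcal{F}$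 of finite graphs if there are constants $C,a'\ge0$ such that for all $G=(W,E)\in\mathcal{F}$, $v\in W$, $S\subseteq W\setminus\{v\}$, feasible $\tau,\tau':S\to\{0,1\}$ and integers $s\ge a'\ln|W|$ such that $\tau,\tau'$ differ only at distance at least $s$ from $v$, it holds that $|R_{G,z}(v,\tau)-R_{G,z}(v,\tau')|\le C\delta^s$. **Theorem.** Assume $C_\phi<\infty$ and $\Delta_\phi>0$, and let $0\le\lambda<e/\Delta_\phi$. There are constants $c_1,c_2>0$, $\alpha\ge0$, $\beta>0$, $a\ge0$, depending only on $\mathbb{X},\nu,\phi,\lambda$ (and not on $\mathbb{V}$ or $n$), such that for every bounded measurable $\mathbb{V}\subseteq\mathbb{X}$ with $\nu(\mathbb{V})>0$ there is a real number $n_0=n_0(\mathbb{V})$ with $c_1\nu(\mathbb{V})\le n_0\le c_2\nu(\mathbb{V})$ for which the following holds. For every integer $n\ge1$ with $n\ge n_0$ there is a family $\mathcal{F}$ of graphs on $[n]$ such that, with $z=\lambda\nu(\mathbb{V})/n$: 1. for $G\sim\zeta^{(n)}_{\mathbb{V},\phi}$, $\Pr[G\in\mathcal{F}]\ge1-\frac1n$;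 2. for every $G\in\mathcal{F}$, every vertex $v\in[n]$, every $S\subseteq[n]\setminus\{v\}$, all feasible $\tau,\tau':S\to\{0,1\}$ and every integer $s\ge a\ln n$ such that $\tau,\tau'$ differ only at distance at least $s$ from $v$, $$|R_{G,z}(v,\tau)-R_{G,z}(v,\tau')|\le\alpha e^{-\beta s};$$ 3. the hard-core model at activity $z$ satisfies strong spatial mixing on $\mathcal{F}$ with decay rate $e^{-\beta}$ (which is independent of $n$ and $\mathbb{V}$). -/

import Mathlib

open MeasureTheory
open scoped ENNReal NNReal

noncomputable section

namespace HardCoreSSM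

/-! ### The hard-core model on a finite graph -/

section HardCore

variable {W : Type*} [Fintype W]

open Classical in
/-- The unnormalized hard-core weight of a spin configuration `σ : W → {0, 1}` (with `true` for spin
`1` and `false` for spin `0`): `z ^ |σ⁻¹(1)|` if `σ⁻¹(1)` is an independent set, and `0` otherwise. -/
def hardCoreWeight (G : SimpleGraph W) (z : ℝ) (σ : W → Bool) : ℝ :=
  if ∃ u w, G.Adj u w ∧ σ u = true ∧ σ w = true then 0
  else z ^ (Finset.univ.filter fun u => σ u = true).card

open Classical in
/-- The hard-core partition function. -/
def hardCorePartition (G : SimpleGraph W) (z : ℝ) : ℝ :=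
  ∑ σ : W → Bool, hardCoreWeight G z σ

open Classical in
/-- The probability of an event under the hard-core Gibbs distribution at vertex activity `z`. -/
def hardCoreProb (G : SimpleGraph W) (z : ℝ) (A : Set (W → Bool)) : ℝ :=
  (∑ σ ∈ Finset.univ.filter (fun σ : W → Bool => σ ∈ A), hardCoreWeight G z σ) /
    hardCorePartition G z

/-- The event that a spin configuration coincides with `τ` on `S`. -/
def agreeOn (S : Set W) (τ : S → Bool) : Set (W → Bool) :=
  {σ | ∀ u : S, σ u = τ u}

/-- A boundary condition is feasible if it has positive probability. -/
def Feasible (G : SimpleGraph W) (z : ℝ) (S : Set W) (τ : S → Bool) : Prop :=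
  0 < hardCoreProb G z (agreeOn S τ)

/-- The conditional hard-core probability of `A` given that the configuration equals `τ` on `S`. -/
def hardCoreCondProb (G : SimpleGraph W) (z : ℝ) (S : Set W) (τ : S → Bool)
    (A : Set (W → Bool)) : ℝ :=
  hardCoreProb G z (A ∩ agreeOn S τ) / hardCoreProb G z (agreeOn S τ)

/-- The occupation ratio of `v` under the boundary condition `τ` on `S`. -/
def occupationRatio (G : SimpleGraph W) (z : ℝ) (S : Set W) (τ : S → Bool) (v : W) : ℝ :=
  hardCoreCondProb G z S τ {σ | σ v = true} / hardCoreCondProb G z S τ {σ | σ v = false}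

/-- `τ` and `τ'` differ only at graph distance at least `s` from `v`. The graph distance is the
extended one, so that vertices outside of the component of `v` are at distance `∞`. -/
def DifferOnlyFrom (G : SimpleGraph W) (v : W) (S : Set W) (τ τ' : S → Bool) (s : ℕ) : Prop :=
  ∀ u : S, τ u ≠ τ' u → (s : ℕ∞) ≤ G.edist v u

end HardCore

/-- Strong spatial mixing, with decay rate `δ`, of the hard-core model at vertex activity `z` on a
family of finite graphs: for all graphs in the family, all `v`, all `S ∌ v`, and all feasible
boundary conditions on `S` that differ only at distance at least `s` from `v`, the occupation ratios
of `v` differ by at most `C * δ ^ s`, as soon as `s` is at least a threshold that is logarithmic in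
the number of vertices of the graph. The constants are uniform over the family. -/
def StrongSpatialMixing (z : ℝ) (F : Set (Σ n : ℕ, SimpleGraph (Fin n))) (δ : ℝ) : Prop :=
  0 ≤ δ ∧ δ < 1 ∧ ∃ C a : ℝ, 0 ≤ C ∧ 0 ≤ a ∧ ∀ (n : ℕ) (G : SimpleGraph (Fin n)),
    (⟨n, G⟩ : Σ n : ℕ, SimpleGraph (Fin n)) ∈ F →
    ∀ (v : Fin n) (S : Set (Fin n)), v ∉ S → ∀ τ τ' : S → Bool,
      Feasible G z S τ → Feasible G z S τ' →
      ∀ s : ℕ, a * Real.log n ≤ s → DifferOnlyFrom G v S τ τ' s →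
        |occupationRatio G z S τ v - occupationRatio G z S τ' v| ≤ C * δ ^ s

/-! ### Repulsive potentials -/

section Potential

/-- `exp (-t)` for `t ∈ [0, ∞]`, with `exp (-∞) = 0`. -/
def expNeg (t : ℝ≥0∞) : ℝ≥0∞ := EReal.exp (-(t : EReal))

variable {X : Type*} [MetricSpace X] [MeasurableSpace X]

/-- The temperedness constant `C_φ = sup_x ∫ |1 - exp (-φ(x, y))| ν(dy)`. (As `φ ≥ 0`, the absolute
value is `1 - exp (-φ(x, y))`.) -/
def temperedness (ν : Measure X) (φ : X → X → ℝ≥0∞) : ℝ≥0∞ :=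
  ⨆ x : X, ∫⁻ y, (1 - expNeg (φ x y)) ∂ν

open Classical in
/-- The product over `1 ≤ j ≤ k` of
`exp (-∑_{0 ≤ i ≤ j - 2} 1[d(y_i, y_j) < d(y_i, y_{i+1})] φ(y_i, y_j)) * (1 - exp (-φ(y_{j-1}, y_j)))`.
The index `j : Fin k` below stands for `j + 1` in this formula. -/
def pathWeight (φ : X → X → ℝ≥0∞) (k : ℕ) (y : Fin (k + 1) → X) : ℝ≥0∞ :=
  ∏ j : Fin k,
    expNeg (∑ i ∈ Finset.univ.filter (fun i : Fin k => i < j),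
        if dist (y i.castSucc) (y j.succ) < dist (y i.castSucc) (y i.succ)
        then φ (y i.castSucc) (y j.succ) else 0) *
      (1 - expNeg (φ (y j.castSucc) (y j.succ)))

/-- `V_0 = 1`, and for `k ≥ 1` the supremum over `x_0` of the integral over `(x_1, …, x_k)` of the
path weight. -/
def pathIntegral (ν : Measure X) (φ : X → X → ℝ≥0∞) (k : ℕ) : ℝ≥0∞ :=
  if k = 0 then 1
  else ⨆ x₀ : X, ∫⁻ x : Fin k → X, pathWeight φ k (Fin.cons x₀ x) ∂(Measure.pi fun _ => ν)

/-- The potential-weighted connective constant `Δ_φ = inf_{k ≥ 1} V_k ^ (1 / k)`, which is also the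
limit of `V_k ^ (1 / k)` because `V` is submultiplicative. -/
def pwcc (ν : Measure X) (φ : X → X → ℝ≥0∞) : ℝ≥0∞ :=
  ⨅ k : {k : ℕ // 1 ≤ k}, pathIntegral ν φ k ^ (1 / ((k : ℕ) : ℝ))

end Potential

/-! ### The random graph -/

section RandomGraph

variable {X : Type*} [MeasurableSpace X]

open Classical in
/-- The probability of the graph `G` on `n` vertices in the random graph model of the graphon `w` on
the probability space `(X, ξ)`: the positions `x_1, …, x_n` are independent with law `ξ`, and given
these each pair `i < j` is joined by an edge independently with probability `w(x_i, x_j)`. -/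
def graphonMass (ξ : Measure X) (w : X → X → ℝ≥0∞) (n : ℕ) (G : SimpleGraph (Fin n)) : ℝ≥0∞ :=
  ∫⁻ x : Fin n → X,
    ∏ p ∈ Finset.univ.filter (fun p : Fin n × Fin n => p.1 < p.2),
      (if G.Adj p.1 p.2 then w (x p.1) (x p.2) else 1 - w (x p.1) (x p.2))
    ∂(Measure.pi fun _ => ξ)

open Classical in
/-- The probability that the random graph on `n` vertices of the potential `φ` on the region `V`
belongs to `F`. The positions are uniform on `V` with respect to `ν`, that is, their law is `ν`
conditioned on `V`, and the edge probability is `1 - exp (-φ(x, y))`. -/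
def randomGraphProb (ν : Measure X) (V : Set X) (φ : X → X → ℝ≥0∞) (n : ℕ)
    (F : Set (SimpleGraph (Fin n))) : ℝ≥0∞ :=
  ∑ G ∈ Finset.univ.filter (fun G : SimpleGraph (Fin n) => G ∈ F),
    graphonMass (ProbabilityTheory.cond ν V) (fun x y => 1 - expNeg (φ x y)) n G

end RandomGraph

end HardCoreSSM

end

/-!
# Strong spatial mixing of the hard-core model on random graphs of a repulsive potential

*Recursion.* Deleting the neighbours `w₁, w₂, …` of `v` one after the other gives
`R(v) = z ∏ i, (1 + R(wᵢ))⁻¹`, where `R(wᵢ)` is an occupation ratio in the graph without `v` and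
`w₁, …, wᵢ` (`ratio_eq_mul_exp`). In the coordinates `u = √(log (1 + R))` this becomes
`u = f(‖(uᵢ)‖₂)` with `f(t) = √(log (1 + z exp (-t²)))`, and `|f'|² ≤ z t² exp (-t²) ≤ z / e`
(`abs_profile_sub_le`). Hence one step of the recursion contracts squared differences by `z / e` and
sums them over the neighbours, so that boundary conditions which agree near `v` yield messages whose
squared difference is at most `(z / e) ^ r z` times the number of walks of length `r` that the
recursion follows (`sq_message_sub_le`).

*Counting.* The order in which neighbours are deleted is free. If every vertex orders the others by
distance, the walks of the recursion are paths that, after a step from `p i` to `p (i + 1)`, avoid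
all neighbours of `p i` that are closer to it than `p (i + 1)`. Given the positions, such a path
occurs in the random graph with probability at most the path weight that defines `V_r`
(`sum_graphWeight_isAdmissible_le`), because the edges involved are distinct. Therefore the expected
number of paths of length `r` is at most `n ^ (r + 1) V_r / ν(V) ^ r`.

*Conclusion.* As `V` is submultiplicative, `λ < e / Δ_φ` provides a number `D` with `λ D < e` and
`∑ V_r / D ^ r < ∞` (`exists_tsum_pathIntegral_ne_top`). Markov's inequality, applied once to the
generating function of the number of paths at `ν(V) / (n D)`, bounds the number of paths of every
length `r` by `M n² (n D / ν(V)) ^ r` with probability at least `1 - 1 / n`. With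
`z = λ ν(V) / n` the squared difference of the messages is then of order `n² (λ D / e) ^ r`, and the
factor `n²` is harmless once `r` exceeds a multiple of `log n` (`decayOfInfluence_of_card_le`). The
threshold `n₀` only has to keep `z` bounded, for which `n₀ = ν(V)` suffices.
-/

noncomputable section

namespace HardCoreSSM

/-! ### Independence sums and the occupation ratio recursion -/

section Recursion

open scoped Classical

variable {W : Type*} {G : SimpleGraph W} {z : ℝ}

/-- The hard-core partition function of the subgraph induced by the finite vertex set `A`. -/
def indepSum (G : SimpleGraph W) (z : ℝ) (A : Finset W) : ℝ :=
  ∑ I ∈ A.powerset.filter (fun I : Finset W => G.IsIndepSet (I : Set W)), z ^ I.card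

/-- The occupation ratio of a vertex `v ∉ A` in the hard-core model on `insert v A`. -/
def ratio (G : SimpleGraph W) (z : ℝ) (A : Finset W) (v : W) : ℝ :=
  z * indepSum G z (A.filter fun w => ¬ G.Adj v w) / indepSum G z A

/-- What is left of `A` when a walk moves from `v` to its neighbour `w`: all neighbours of `v` up to
and including `w` are deleted, in the order of the keys that `v` gives to the vertices. -/
def pruned {K : Type*} [LinearOrder K] (G : SimpleGraph W) (key : W → W → K) (A : Finset W)
    (v w : W) : Finset W :=
  A.filter fun w' => ¬ (G.Adj v w' ∧ key v w' ≤ key v w)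

lemma indepSum_pos (hz : 0 ≤ z) (A : Finset W) : 0 < indepSum G z A := by
  have h : (∅ : Finset W) ∈ A.powerset.filter fun I : Finset W => G.IsIndepSet (I : Set W) := by
    simp [SimpleGraph.IsIndepSet]
  calc (0 : ℝ) < z ^ (∅ : Finset W).card := by simp
    _ ≤ _ := Finset.single_le_sum (f := fun I : Finset W => z ^ I.card)
      (fun I _ => pow_nonneg hz _) h

lemma indepSum_mono (hz : 0 ≤ z) {A B : Finset W} (h : A ⊆ B) :
    indepSum G z A ≤ indepSum G z B := by
  refine Finset.sum_le_sum_of_subset_of_nonneg ?_ fun I _ _ => pow_nonneg hz _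
  exact Finset.filter_subset_filter _ (Finset.powerset_mono.2 h)

lemma indepSum_insert {A : Finset W} {v : W} (hv : v ∉ A) :
    indepSum G z (insert v A) =
      indepSum G z A + z * indepSum G z (A.filter fun w => ¬ G.Adj v w) := by
  simp only [indepSum, Finset.sum_filter, Finset.sum_powerset_insert hv]
  congr 1
  rw [Finset.mul_sum, ← Finset.sum_subset (s₁ := (A.filter fun w => ¬ G.Adj v w).powerset)
    (Finset.powerset_mono.2 (Finset.filter_subset _ _))]
  · refine Finset.sum_congr rfl fun I hI => ?_
    have hI' : ∀ w ∈ I, w ∈ A ∧ ¬ G.Adj v w := fun w hw => by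
      simpa using Finset.mem_powerset.1 hI hw
    have hvI : v ∉ I := fun h => hv (hI' v h).1
    have : G.IsIndepSet (insert v I : Finset W) ↔ G.IsIndepSet (I : Set W) := by
      rw [Finset.coe_insert]
      constructor
      · exact fun h => h.mono (Set.subset_insert _ _)
      · intro h
        exact Set.pairwise_insert.2
          ⟨h, fun w hw _ => ⟨(hI' w hw).2, fun h' => (hI' w hw).2 h'.symm⟩⟩
    simp only [this, Finset.card_insert_of_notMem hvI, pow_succ]
    split_ifs <;> ring
  · intro I hI hI'
    rw [if_neg]
    intro h
    apply hI'
    rw [Finset.mem_powerset] at hI ⊢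
    intro w hw
    refine Finset.mem_filter.2 ⟨hI hw, ?_⟩
    exact h (by simp) (by simp [hw]) (by rintro rfl; exact hv (hI hw))

lemma indepSum_insert_eq_mul (hz : 0 ≤ z) {A : Finset W} {v : W} (hv : v ∉ A) :
    indepSum G z (insert v A) = indepSum G z A * (1 + ratio G z A v) := by
  have := (indepSum_pos (G := G) hz A).ne'
  rw [indepSum_insert hv, ratio]
  field_simp

lemma ratio_nonneg (hz : 0 ≤ z) (A : Finset W) (v : W) : 0 ≤ ratio G z A v :=
  div_nonneg (mul_nonneg hz (indepSum_pos hz _).le) (indepSum_pos hz _).le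

lemma ratio_le (hz : 0 ≤ z) (A : Finset W) (v : W) : ratio G z A v ≤ z := by
  rw [ratio, div_le_iff₀ (indepSum_pos hz _)]
  exact mul_le_mul_of_nonneg_left (indepSum_mono hz (Finset.filter_subset _ _)) hz

/-- Deleting the vertices of `N` from `A` one by one, in the order of their keys, factorizes the
partition function. -/
lemma log_indepSum_sdiff {K : Type*} [LinearOrder K] (hz : 0 ≤ z) {f : W → K}
    (hf : Function.Injective f) (A N : Finset W) (hN : N ⊆ A) :
    Real.log (indepSum G z A) = Real.log (indepSum G z (A \ N)) +
      ∑ w ∈ N, Real.log (1 + ratio G z (A.filter fun w' => ¬ (w' ∈ N ∧ f w' ≤ f w)) w) := by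
  induction N using Finset.induction_on_max_value f with
  | empty => simp
  | insert m N hm hmax ih =>
    have hmA : m ∈ A := hN (Finset.mem_insert_self _ _)
    have hlast : (A.filter fun w' => ¬ (w' ∈ insert m N ∧ f w' ≤ f m)) = A \ insert m N := by
      ext w
      simp only [Finset.mem_filter, Finset.mem_sdiff, Finset.mem_insert]
      constructor
      · rintro ⟨h1, h2⟩
        refine ⟨h1, fun h => h2 ⟨h, ?_⟩⟩
        rcases h with rfl | h
        · exact le_rfl
        · exact hmax _ h
      · rintro ⟨h1, h2⟩
        exact ⟨h1, fun h => h2 h.1⟩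
    have hins : A \ N = insert m (A \ insert m N) := by
      ext w
      by_cases h : w = m
      · subst h; simp [hmA, hm]
      · simp [h]
    have hrest : ∀ w ∈ N, (A.filter fun w' => ¬ (w' ∈ insert m N ∧ f w' ≤ f w)) =
        A.filter fun w' => ¬ (w' ∈ N ∧ f w' ≤ f w) := by
      intro w hw
      refine Finset.filter_congr fun w' _ => ?_
      have hlt : f w < f m := lt_of_le_of_ne (hmax w hw) fun h => hm (hf h ▸ hw)
      by_cases h : w' = m
      · subst h; simp [hm, not_le.2 hlt]
      · simp [h]
    have hpos := ratio_nonneg (G := G) hz (A \ insert m N) m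
    rw [ih ((Finset.subset_insert _ _).trans hN), Finset.sum_insert hm, hlast, hins,
      indepSum_insert_eq_mul hz (by simp), Real.log_mul (indepSum_pos hz _).ne' (by positivity),
      Finset.sum_congr rfl fun w hw => by rw [← hrest w hw]]
    ring

/-- The occupation ratio in the coordinates `√(log (1 + R))`, in which the recursion is a Euclidean
contraction. -/
def message (G : SimpleGraph W) (z : ℝ) (A : Finset W) (v : W) : ℝ :=
  √(Real.log (1 + ratio G z A v))

lemma message_sq (hz : 0 ≤ z) (A : Finset W) (v : W) :
    message G z A v ^ 2 = Real.log (1 + ratio G z A v) :=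
  Real.sq_sqrt (Real.log_nonneg (by linarith [ratio_nonneg (G := G) hz A v]))

lemma message_sq_le (hz : 0 ≤ z) (A : Finset W) (v : W) : message G z A v ^ 2 ≤ z := by
  rw [message_sq hz]
  have h0 := ratio_nonneg (G := G) hz A v
  have h1 := ratio_le (G := G) hz A v
  linarith [Real.log_le_sub_one_of_pos (show 0 < 1 + ratio G z A v by linarith)]

/-- The recursion for the occupation ratio. -/
lemma ratio_eq_mul_exp {K : Type*} [LinearOrder K] (hz : 0 ≤ z) {key : W → W → K}
    (hkey : ∀ v, Function.Injective (key v)) (A : Finset W) (v : W) :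
    ratio G z A v = z * Real.exp
      (-∑ w ∈ A.filter (fun w => G.Adj v w), message G z (pruned G key A v w) w ^ 2) := by
  have h := log_indepSum_sdiff (G := G) hz (hkey v) A (A.filter fun w => G.Adj v w)
    (Finset.filter_subset _ _)
  have h1 : A \ A.filter (fun w => G.Adj v w) = A.filter fun w => ¬ G.Adj v w := by
    ext w; simp; tauto
  have h2 : ∀ w, (A.filter fun w' => ¬ (w' ∈ A.filter (fun w => G.Adj v w) ∧ key v w' ≤ key v w)) =
      pruned G key A v w := by
    intro w
    refine Finset.filter_congr fun w' hw' => ?_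
    simp [hw']
  simp only [h1, h2] at h
  simp only [message_sq hz]
  have e : -∑ w ∈ A.filter (fun w => G.Adj v w), Real.log (1 + ratio G z (pruned G key A v w) w) =
      Real.log (indepSum G z (A.filter fun w => ¬ G.Adj v w)) - Real.log (indepSum G z A) := by
    linarith
  rw [e, Real.exp_sub, Real.exp_log (indepSum_pos hz _), Real.exp_log (indepSum_pos hz _), ratio,
    mul_div_assoc]

/-- The recursion for messages as a function of the Euclidean norm of the incoming messages. -/
def profile (z t : ℝ) : ℝ := √(Real.log (1 + z * Real.exp (-t ^ 2)))

/-- The derivative of `profile z` at `t` is `-t R / ((1 + R) √(log (1 + R)))` with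
`R = z exp (-t ^ 2)`; its square is at most `t ^ 2 R = z t ^ 2 exp (-t ^ 2) ≤ z / e`. -/
lemma abs_profile_sub_le (hz : 0 < z) (s t : ℝ) :
    |profile z s - profile z t| ≤ √(z / Real.exp 1) * |s - t| := by
  have key : ∀ t : ℝ, ∃ d : ℝ, HasDerivAt (profile z) d t ∧ |d| ≤ √(z / Real.exp 1) := by
    intro t
    set R := z * Real.exp (-t ^ 2) with hR
    have hRpos : 0 < R := by positivity
    have hlog : 0 < Real.log (1 + R) := Real.log_pos (by linarith)
    have h1 : HasDerivAt (fun t : ℝ => 1 + z * Real.exp (-t ^ 2))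
        (z * (Real.exp (-t ^ 2) * (-(2 * t)))) t := by
      have := (((hasDerivAt_pow 2 t).neg).exp.const_mul z).const_add 1
      simpa using this
    have h2 := (h1.log (by rw [← hR]; positivity)).sqrt (by rw [← hR]; exact hlog.ne')
    refine ⟨_, h2, ?_⟩
    rw [← hR]
    apply Real.abs_le_sqrt
    have hexp : t ^ 2 * Real.exp (-t ^ 2) ≤ 1 / Real.exp 1 := by
      have := Real.add_one_le_exp (t ^ 2 - 1)
      rw [Real.exp_neg, ← div_eq_mul_inv, div_le_div_iff₀ (Real.exp_pos _) (Real.exp_pos _)]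
      have h3 : t ^ 2 ≤ Real.exp (t ^ 2) / Real.exp 1 := by
        rw [← Real.exp_sub]; linarith
      rw [le_div_iff₀ (Real.exp_pos _)] at h3
      linarith
    have hlow : R / (1 + R) ≤ Real.log (1 + R) := by
      have := Real.one_sub_inv_le_log_of_pos (show 0 < 1 + R by linarith)
      calc R / (1 + R) = 1 - (1 + R)⁻¹ := by field_simp; ring
        _ ≤ _ := this
    have e : (z * (Real.exp (-t ^ 2) * (-(2 * t))) / (1 + R) / (2 * √(Real.log (1 + R)))) ^ 2 =
        t ^ 2 * R ^ 2 / ((1 + R) ^ 2 * Real.log (1 + R)) := by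
      rw [div_pow, mul_pow 2, Real.sq_sqrt hlog.le, hR]
      field_simp
    rw [e]
    calc t ^ 2 * R ^ 2 / ((1 + R) ^ 2 * Real.log (1 + R))
        ≤ t ^ 2 * R ^ 2 / ((1 + R) ^ 2 * (R / (1 + R))) := by gcongr
      _ = t ^ 2 * R / (1 + R) := by field_simp
      _ ≤ t ^ 2 * R := div_le_self (by positivity) (by linarith)
      _ = z * (t ^ 2 * Real.exp (-t ^ 2)) := by rw [hR]; ring
      _ ≤ z * (1 / Real.exp 1) := by gcongr
      _ = _ := by ring
  choose d hd hb using key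
  have := Convex.norm_image_sub_le_of_norm_hasDerivWithin_le (f := profile z) (f' := d)
    (s := Set.univ) (x := t) (y := s) (C := √(z / Real.exp 1))
    (fun x _ => (hd x).hasDerivWithinAt) (fun x _ => hb x) convex_univ trivial trivial
  simpa [Real.norm_eq_abs] using this

lemma message_eq_profile {K : Type*} [LinearOrder K] (hz : 0 ≤ z) {key : W → W → K}
    (hkey : ∀ v, Function.Injective (key v)) (A : Finset W) (v : W) :
    message G z A v = profile z
      √(∑ w ∈ A.filter (fun w => G.Adj v w), message G z (pruned G key A v w) w ^ 2) := by
  rw [message, ratio_eq_mul_exp hz hkey, profile,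
    Real.sq_sqrt (Finset.sum_nonneg fun _ _ => sq_nonneg _)]

/-- The reverse triangle inequality for the Euclidean norm. -/
lemma sq_sqrt_sum_sub_le {ι : Type*} (N : Finset ι) (a b : ι → ℝ) :
    (√(∑ i ∈ N, a i ^ 2) - √(∑ i ∈ N, b i ^ 2)) ^ 2 ≤ ∑ i ∈ N, (a i - b i) ^ 2 := by
  have h := Real.sum_mul_le_sqrt_mul_sqrt N a b
  have h1 := Real.sq_sqrt (Finset.sum_nonneg fun i (_ : i ∈ N) => sq_nonneg (a i))
  have h2 := Real.sq_sqrt (Finset.sum_nonneg fun i (_ : i ∈ N) => sq_nonneg (b i))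
  have h3 : ∑ i ∈ N, (a i - b i) ^ 2 =
      ∑ i ∈ N, a i ^ 2 + ∑ i ∈ N, b i ^ 2 - 2 * ∑ i ∈ N, a i * b i := by
    rw [Finset.mul_sum, ← Finset.sum_add_distrib, ← Finset.sum_sub_distrib]
    exact Finset.sum_congr rfl fun i _ => by ring
  nlinarith

/-- The number of walks of length `r` from `v` into `A` that are followed by the recursion. -/
def walkCount {K : Type*} [LinearOrder K] (G : SimpleGraph W) (key : W → W → K) :
    ℕ → Finset W → W → ℕ
  | 0, _, _ => 1
  | r + 1, A, v => ∑ w ∈ A.filter (fun w => G.Adj v w), walkCount G key r (pruned G key A v w) w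

/-- Decay of correlations along the recursion: the messages from two vertex sets that agree on the
ball of radius `r` around `v` are close if there are few walks of length `r`. -/
lemma sq_message_sub_le {K : Type*} [LinearOrder K] (hz : 0 < z) {key : W → W → K}
    (hkey : ∀ v, Function.Injective (key v)) (r : ℕ) (A A' : Finset W) (v : W)
    (hA : ∀ w, G.edist v w ≤ r → (w ∈ A ↔ w ∈ A')) :
    (message G z A v - message G z A' v) ^ 2 ≤
      (z / Real.exp 1) ^ r * z * walkCount G key r A v := by
  induction r generalizing A A' v with
  | zero =>
    have h1 := message_sq_le (G := G) hz.le A v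
    have h2 := message_sq_le (G := G) hz.le A' v
    have h3 : 0 ≤ message G z A v := Real.sqrt_nonneg _
    have h4 : 0 ≤ message G z A' v := Real.sqrt_nonneg _
    simp only [walkCount]
    norm_num
    nlinarith [mul_nonneg h3 h4]
  | succ r ih =>
    have hN : A'.filter (fun w => G.Adj v w) = A.filter fun w => G.Adj v w := by
      ext w
      simp only [Finset.mem_filter]
      refine and_congr_left fun h => (hA w ?_).symm
      rw [SimpleGraph.edist_eq_one_iff_adj.2 h]
      exact_mod_cast Nat.succ_le_succ (Nat.zero_le r)
    rw [message_eq_profile hz.le hkey A v, message_eq_profile hz.le hkey A' v, hN]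
    have hq : 0 ≤ z / Real.exp 1 := by positivity
    calc _ ≤ (z / Real.exp 1) * (√(∑ w ∈ A.filter (fun w => G.Adj v w),
              message G z (pruned G key A v w) w ^ 2) -
            √(∑ w ∈ A.filter (fun w => G.Adj v w),
              message G z (pruned G key A' v w) w ^ 2)) ^ 2 := by
          rw [← sq_abs (profile _ _ - _), ← sq_abs (√_ - √_), ← Real.sq_sqrt hq, ← mul_pow]
          exact pow_le_pow_left₀ (abs_nonneg _) (abs_profile_sub_le hz _ _) 2
      _ ≤ (z / Real.exp 1) * ∑ w ∈ A.filter (fun w => G.Adj v w),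
            (message G z (pruned G key A v w) w - message G z (pruned G key A' v w) w) ^ 2 := by
          gcongr
          exact sq_sqrt_sum_sub_le _ _ _
      _ ≤ (z / Real.exp 1) * ∑ w ∈ A.filter (fun w => G.Adj v w),
            (z / Real.exp 1) ^ r * z * walkCount G key r (pruned G key A v w) w := by
          gcongr with w hw
          refine ih _ _ _ fun w' hw' => ?_
          simp only [pruned, Finset.mem_filter]
          refine and_congr_left fun _ => hA w' ?_
          refine (SimpleGraph.edist_triangle (v := w)).trans ?_
          rw [SimpleGraph.edist_eq_one_iff_adj.2 (Finset.mem_filter.1 hw).2, add_comm]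
          push_cast
          gcongr
      _ = _ := by
          simp only [walkCount, ← Finset.mul_sum]
          push_cast
          ring

/-- The change of the ratio in terms of the change of the message. -/
lemma abs_ratio_sub_le (hz : 0 ≤ z) (A A' : Finset W) (v : W) :
    |ratio G z A v - ratio G z A' v| ≤
      (1 + z) * (2 * √z) * |message G z A v - message G z A' v| := by
  have aux : ∀ x y : ℝ, 0 ≤ x → 0 ≤ y → x ≤ z → y ≤ z →
      x - y ≤ (1 + z) * |Real.log (1 + x) - Real.log (1 + y)| := by
    intro x y hx hy hxz hyz
    have h1 : 1 - (1 + y) / (1 + x) ≤ Real.log (1 + x) - Real.log (1 + y) := by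
      have := Real.one_sub_inv_le_log_of_pos (show 0 < (1 + x) / (1 + y) by positivity)
      rwa [Real.log_div (by positivity) (by positivity), inv_div] at this
    have h2 : 1 - (1 + y) / (1 + x) = (x - y) / (1 + x) := by field_simp; ring
    rw [h2, div_le_iff₀ (by positivity)] at h1
    calc x - y ≤ _ := h1
      _ ≤ |Real.log (1 + x) - Real.log (1 + y)| * (1 + z) := by
          refine mul_le_mul (le_abs_self _) (by linarith) (by linarith) (abs_nonneg _)
      _ = _ := mul_comm _ _
  have h0 := ratio_nonneg (G := G) hz A v
  have h1 := ratio_le (G := G) hz A v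
  have h0' := ratio_nonneg (G := G) hz A' v
  have h1' := ratio_le (G := G) hz A' v
  have h2 : |ratio G z A v - ratio G z A' v| ≤
      (1 + z) * |message G z A v ^ 2 - message G z A' v ^ 2| := by
    rw [message_sq hz, message_sq hz]
    refine abs_le'.2 ⟨aux _ _ h0 h0' h1 h1', ?_⟩
    rw [neg_sub, abs_sub_comm]
    exact aux _ _ h0' h0 h1' h1
  have h3 : message G z A v ≤ √z := Real.le_sqrt_of_sq_le (message_sq_le hz _ _)
  have h4 : message G z A' v ≤ √z := Real.le_sqrt_of_sq_le (message_sq_le hz _ _)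
  have h5 : 0 ≤ message G z A v := Real.sqrt_nonneg _
  have h6 : 0 ≤ message G z A' v := Real.sqrt_nonneg _
  refine h2.trans ?_
  rw [mul_assoc]
  gcongr
  rw [sq_sub_sq, abs_mul, abs_of_nonneg (by positivity)]
  gcongr
  linarith

end Recursion

/-! ### Occupation ratios under boundary conditions -/

section Boundary

lemma edist_lt_of_adj {W : Type*} {G : SimpleGraph W} {v u w : W} {s r : ℕ} (hr : r + 2 = s)
    (h : G.edist v w ≤ r) (hwu : G.Adj w u) : G.edist v u < s := by
  refine lt_of_le_of_lt (SimpleGraph.edist_triangle (v := w)) ?_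
  rw [SimpleGraph.edist_eq_one_iff_adj.2 hwu]
  refine lt_of_le_of_lt (add_le_add_left h 1) ?_
  exact_mod_cast (by omega : r + 1 < s)

open scoped Classical

variable {W : Type*} [Fintype W] {G : SimpleGraph W} {z : ℝ}

/-- The total weight of the configurations that are prescribed off `U`, where `T` is the set of the
occupied vertices off `U`. -/
lemma sum_hardCoreWeight_eq (T U : Finset W) (hTU : Disjoint T U) :
    ∑ σ ∈ Finset.univ.filter (fun σ : W → Bool => ∀ u, u ∉ U → (σ u = true ↔ u ∈ T)),
      hardCoreWeight G z σ =
    if G.IsIndepSet (T : Set W) then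
      z ^ T.card * indepSum G z (U.filter fun u => ∀ t ∈ T, ¬ G.Adj t u) else 0 := by
  have h1 : ∑ σ ∈ Finset.univ.filter (fun σ : W → Bool => ∀ u, u ∉ U → (σ u = true ↔ u ∈ T)),
      hardCoreWeight G z σ =
      ∑ J ∈ U.powerset, if G.IsIndepSet ((T ∪ J : Finset W) : Set W) then
        z ^ T.card * z ^ J.card else 0 := by
    refine Finset.sum_bij' (fun σ _ => U.filter fun u => σ u = true)
      (fun J _ => fun u => decide (u ∈ T ∪ J)) ?_ ?_ ?_ ?_ ?_
    · intro σ _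
      exact Finset.mem_powerset.2 (Finset.filter_subset _ _)
    · intro J hJ
      have hJ := Finset.mem_powerset.1 hJ
      simp only [Finset.mem_filter, Finset.mem_univ, true_and, decide_eq_true_eq, Finset.mem_union]
      exact fun u hu => ⟨fun h => h.resolve_right fun h => hu (hJ h), Or.inl⟩
    · intro σ hσ
      have hσ := (Finset.mem_filter.1 hσ).2
      funext u
      rw [Bool.eq_iff_iff]
      by_cases hu : u ∈ U
      · have : u ∉ T := fun h => (Finset.disjoint_left.1 hTU) h hu
        simp [hu, this]
      · simp [hu, hσ u hu]
    · intro J hJ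
      have hJ := Finset.mem_powerset.1 hJ
      ext u
      simp only [Finset.mem_filter, decide_eq_true_eq, Finset.mem_union]
      constructor
      · rintro ⟨hu, h | h⟩
        · exact ((Finset.disjoint_left.1 hTU) h hu).elim
        · exact h
      · exact fun h => ⟨hJ h, Or.inr h⟩
    · intro σ hσ
      have hσ := (Finset.mem_filter.1 hσ).2
      have hset : (Finset.univ.filter fun u => σ u = true) =
          T ∪ U.filter fun u => σ u = true := by
        ext u
        by_cases hu : u ∈ U
        · have : u ∉ T := fun h => (Finset.disjoint_left.1 hTU) h hu
          simp [hu, this]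
        · simp [hu, hσ u hu]
      have hmem : ∀ u, u ∈ T ∪ (U.filter fun u => σ u = true) ↔ σ u = true := by
        intro u; rw [← hset]; simp
      rw [hardCoreWeight, hset, Finset.card_union_of_disjoint
        (hTU.mono_right (Finset.filter_subset _ _)), pow_add]
      by_cases h : ∃ u w, G.Adj u w ∧ σ u = true ∧ σ w = true
      · rw [if_pos h, if_neg]
        obtain ⟨u, w, huw, hu, hw⟩ := h
        exact fun hI => hI ((hmem u).2 hu) ((hmem w).2 hw) huw.ne huw
      · rw [if_neg h, if_pos]
        intro u hu w hw _ huw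
        exact h ⟨u, w, huw, (hmem u).1 hu, (hmem w).1 hw⟩
  rw [h1]
  split_ifs with hT
  · rw [indepSum, Finset.mul_sum, ← Finset.sum_filter]
    refine Finset.sum_congr ?_ fun _ _ => rfl
    ext J
    simp only [Finset.mem_filter, Finset.mem_powerset]
    constructor
    · rintro ⟨hJ, hI⟩
      refine ⟨fun u hu => Finset.mem_filter.2 ⟨hJ hu, fun t ht => ?_⟩,
        hI.mono (by exact_mod_cast Finset.subset_union_right)⟩
      exact hI (by simp [ht]) (by simp [hu])
        (by rintro rfl; exact (Finset.disjoint_left.1 hTU) ht (hJ hu))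
    · rintro ⟨hJ, hI⟩
      refine ⟨hJ.trans (Finset.filter_subset _ _), ?_⟩
      intro a ha b hb hab
      simp only [Finset.coe_union, Set.mem_union, Finset.mem_coe] at ha hb
      rcases ha with ha | ha <;> rcases hb with hb | hb
      · exact hT ha hb hab
      · exact (Finset.mem_filter.1 (hJ hb)).2 a ha
      · exact fun h => (Finset.mem_filter.1 (hJ ha)).2 b hb h.symm
      · exact hI ha hb hab
  · refine Finset.sum_eq_zero fun J _ => if_neg fun h => hT (h.mono ?_)
    exact_mod_cast Finset.subset_union_left

lemma hardCoreProb_eq_div (T U : Finset W) (hTU : Disjoint T U) :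
    hardCoreProb G z {σ | ∀ u, u ∉ U → (σ u = true ↔ u ∈ T)} =
    (if G.IsIndepSet (T : Set W) then
      z ^ T.card * indepSum G z (U.filter fun u => ∀ t ∈ T, ¬ G.Adj t u) else 0) /
        hardCorePartition G z := by
  rw [hardCoreProb, ← sum_hardCoreWeight_eq T U hTU]
  congr 1
  exact Finset.sum_congr (by ext; simp) fun _ _ => rfl

/-- The vertices that are occupied under a boundary condition. -/
def occupied (S : Set W) (τ : S → Bool) : Finset W :=
  Finset.univ.filter fun u => ∃ h : u ∈ S, τ ⟨u, h⟩ = true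

/-- The vertices other than `v` that are neither fixed nor blocked by a boundary condition. -/
def freePart (G : SimpleGraph W) (S : Set W) (τ : S → Bool) (v : W) : Finset W :=
  (Finset.univ.filter fun u => u ∉ S ∧ u ≠ v).filter fun u => ∀ t ∈ occupied S τ, ¬ G.Adj t u

/-- Conditioning on a boundary condition amounts to deleting the fixed and the blocked vertices. -/
lemma occupationRatio_eq {S : Set W} {τ : S → Bool} {v : W} (hv : v ∉ S)
    (hτ : Feasible G z S τ) :
    occupationRatio G z S τ v =
      if ∃ u ∈ occupied S τ, G.Adj v u then 0 else ratio G z (freePart G S τ v) v := by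
  set T := occupied S τ with hTdef
  set U := Finset.univ.filter fun u => u ∉ S ∧ u ≠ v with hUdef
  have hTS : ∀ u ∈ T, u ∈ S := fun u hu => (Finset.mem_filter.1 hu).2.1
  have hvT : v ∉ T := fun h => hv (hTS v h)
  have hTU : Disjoint T U := Finset.disjoint_left.2 fun u hu hu' =>
    (Finset.mem_filter.1 hu').2.1 (hTS u hu)
  have hvTU : Disjoint (insert v T) U := by
    rw [Finset.disjoint_insert_left]
    exact ⟨by simp [hUdef], hTU⟩
  have hτT : ∀ (u : W) (h : u ∈ S), τ ⟨u, h⟩ = true ↔ u ∈ T := by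
    intro u h
    simp [hTdef, occupied, h]
  have hoff : ∀ u, u ∉ U ↔ (u ∈ S ∨ u = v) := by
    intro u
    simp only [hUdef, Finset.mem_filter, Finset.mem_univ, true_and]
    tauto
  have hfalse : {σ : W → Bool | σ v = false} ∩ agreeOn S τ =
      {σ | ∀ u, u ∉ U → (σ u = true ↔ u ∈ T)} := by
    ext σ
    simp only [Set.mem_inter_iff, Set.mem_ofPred_eq, agreeOn, hoff]
    constructor
    · rintro ⟨h1, h2⟩ u (hu | rfl)
      · rw [h2 ⟨u, hu⟩, hτT]
      · simp [h1, hvT]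
    · intro h
      refine ⟨?_, fun u => ?_⟩
      · have := h v (Or.inr rfl)
        simpa [hvT] using this
      · rw [Bool.eq_iff_iff, hτT u u.2]
        exact h u (Or.inl u.2)
  have htrue : {σ : W → Bool | σ v = true} ∩ agreeOn S τ =
      {σ | ∀ u, u ∉ U → (σ u = true ↔ u ∈ insert v T)} := by
    ext σ
    simp only [Set.mem_inter_iff, Set.mem_ofPred_eq, agreeOn, hoff, Finset.mem_insert]
    constructor
    · rintro ⟨h1, h2⟩ u (hu | rfl)
      · have : u ≠ v := fun h => hv (h ▸ hu)
        simp [h2 ⟨u, hu⟩, hτT, this]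
      · simp [h1]
    · intro h
      refine ⟨?_, fun u => ?_⟩
      · have := h v (Or.inr rfl)
        simpa using this
      · have hne : (u : W) ≠ v := fun h => hv (h ▸ u.2)
        rw [Bool.eq_iff_iff, hτT u u.2]
        simpa [hne] using h u (Or.inl u.2)
  have hsplit : hardCoreProb G z (agreeOn S τ) =
      hardCoreProb G z ({σ | σ v = true} ∩ agreeOn S τ) +
        hardCoreProb G z ({σ | σ v = false} ∩ agreeOn S τ) := by
    rw [hardCoreProb, hardCoreProb, hardCoreProb, ← add_div,
      ← Finset.sum_filter_add_sum_filter_not _ (fun σ : W → Bool => σ v = true)]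
    congr 2 <;> exact Finset.sum_congr (by ext; simp [and_comm]) fun _ _ => rfl
  have hfeas := hτ
  rw [Feasible, hsplit, htrue, hfalse, hardCoreProb_eq_div _ _ hTU,
    hardCoreProb_eq_div _ _ hvTU] at hfeas
  have hind : G.IsIndepSet (insert v T : Finset W) ↔
      G.IsIndepSet (T : Set W) ∧ ¬ ∃ u ∈ T, G.Adj v u := by
    rw [Finset.coe_insert]
    constructor
    · intro h
      refine ⟨h.mono (Set.subset_insert _ _), ?_⟩
      rintro ⟨u, hu, huv⟩
      exact h (by simp) (by simp [hu]) huv.ne huv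
    · rintro ⟨h1, h2⟩
      exact Set.pairwise_insert.2 ⟨h1, fun w hw _ =>
        ⟨fun h' => h2 ⟨w, hw, h'⟩, fun h' => h2 ⟨w, hw, h'.symm⟩⟩⟩
  -- Feasibility makes the common factor `z ^ |T|` of both weights nonzero, also if `z = 0`.
  have hT : G.IsIndepSet (T : Set W) := by
    by_contra hT
    rw [if_neg hT, if_neg fun h => hT (hind.1 h).1] at hfeas
    simp at hfeas
  have hzT : z ^ T.card ≠ 0 := by
    intro h0
    rw [Finset.card_insert_of_notMem hvT, pow_succ, h0] at hfeas
    simp at hfeas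
  have hpart : hardCorePartition G z ≠ 0 := by
    intro h0
    rw [h0] at hfeas
    simp at hfeas
  rw [occupationRatio, hardCoreCondProb, hardCoreCondProb, div_div_div_cancel_right₀ hτ.ne',
    htrue, hfalse, hardCoreProb_eq_div _ _ hTU, hardCoreProb_eq_div _ _ hvTU,
    div_div_div_cancel_right₀ hpart, if_pos hT]
  have hfree : freePart G S τ v = U.filter fun u => ∀ t ∈ T, ¬ G.Adj t u := rfl
  by_cases hadj : ∃ u ∈ T, G.Adj v u
  · rw [if_neg fun h => (hind.1 h).2 hadj, if_pos hadj, zero_div]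
  · rw [if_pos (hind.2 ⟨hT, hadj⟩), if_neg hadj, ratio, hfree, Finset.card_insert_of_notMem hvT,
      pow_succ, mul_assoc, mul_div_mul_left _ _ hzT]
    congr 3
    ext u
    simp only [Finset.mem_filter, Finset.mem_insert, forall_eq_or_imp]
    tauto

/-- Boundary conditions that differ only at distance at least `r + 2` block the same vertices of the
ball of radius `r`. -/
lemma blocked_iff_of_differOnlyFrom {S : Set W} {τ τ' : S → Bool} {v : W} {s r : ℕ}
    (hr : r + 2 = s) (hd : DifferOnlyFrom G v S τ τ' s) {w : W} (hw : G.edist v w ≤ r) :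
    (∃ u ∈ occupied S τ, G.Adj w u) ↔ ∃ u ∈ occupied S τ', G.Adj w u := by
  refine exists_congr fun u => and_congr_left fun hwu => ?_
  simp only [occupied, Finset.mem_filter, Finset.mem_univ, true_and]
  refine exists_congr fun hu => ?_
  have : τ ⟨u, hu⟩ = τ' ⟨u, hu⟩ := by
    by_contra hne
    exact absurd (hd ⟨u, hu⟩ hne) (not_le.2 (edist_lt_of_adj hr hw hwu))
  rw [this]

lemma mem_freePart_iff {S : Set W} {τ : S → Bool} {v w : W} :
    w ∈ freePart G S τ v ↔ (w ∉ S ∧ w ≠ v) ∧ ¬ ∃ u ∈ occupied S τ, G.Adj w u := by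
  simp [freePart, G.adj_comm]

/-- Decay of the influence of boundary conditions in terms of the number of walks from `v`. -/
lemma abs_occupationRatio_sub_le {K : Type*} [LinearOrder K] (hz : 0 ≤ z) {key : W → W → K}
    (hkey : ∀ v, Function.Injective (key v)) {S : Set W} {τ τ' : S → Bool} {v : W} (hv : v ∉ S)
    (hτ : Feasible G z S τ) (hτ' : Feasible G z S τ') {s r : ℕ} (hr : r + 2 = s)
    (hd : DifferOnlyFrom G v S τ τ' s) :
    |occupationRatio G z S τ v - occupationRatio G z S τ' v| ≤ (1 + z) * (2 * √z) *
      √((z / Real.exp 1) ^ r * z * walkCount G key r (freePart G S τ v) v) := by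
  rw [occupationRatio_eq hv hτ, occupationRatio_eq hv hτ']
  simp only [← blocked_iff_of_differOnlyFrom hr hd (w := v) (by simp)]
  split_ifs with h
  · rw [sub_zero, abs_zero]
    positivity
  · refine (abs_ratio_sub_le hz _ _ _).trans ?_
    gcongr
    rcases hz.eq_or_lt with rfl | hz
    · simp [message, ratio]
    refine Real.abs_le_sqrt (sq_message_sub_le hz hkey r _ _ v fun w hw => ?_)
    rw [mem_freePart_iff, mem_freePart_iff, blocked_iff_of_differOnlyFrom hr hd hw]

lemma occupationRatio_mem_Icc (hz : 0 ≤ z) {S : Set W} {τ : S → Bool} {v : W} (hv : v ∉ S)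
    (hτ : Feasible G z S τ) : occupationRatio G z S τ v ∈ Set.Icc 0 z := by
  rw [occupationRatio_eq hv hτ]
  split_ifs
  · exact ⟨le_rfl, hz⟩
  · exact ⟨ratio_nonneg hz _ _, ratio_le hz _ _⟩

end Boundary

/-! ### Admissible paths -/

section Paths

open scoped Classical

variable {W : Type*} [Fintype W] {G : SimpleGraph W} {K : Type*} [LinearOrder K]

/-- A path `p 0, …, p r` in `G` is admissible if, at every step, it avoids all later on the
neighbours of the current vertex that precede the next one. -/
def IsAdmissible (G : SimpleGraph W) (key : W → W → K) (r : ℕ) (p : Fin (r + 1) → W) : Prop :=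
  Function.Injective p ∧ (∀ j : Fin r, G.Adj (p j.castSucc) (p j.succ)) ∧
    ∀ i j : Fin r, i < j → key (p i.castSucc) (p j.succ) < key (p i.castSucc) (p i.succ) →
      ¬ G.Adj (p i.castSucc) (p j.succ)

/-- The admissible paths of length `r` from `v` into `A`. -/
def admissiblePaths (G : SimpleGraph W) (key : W → W → K) (r : ℕ) (A : Finset W) (v : W) :
    Finset (Fin (r + 1) → W) :=
  Finset.univ.filter fun p => p 0 = v ∧ IsAdmissible G key r p ∧ ∀ j : Fin r, p j.succ ∈ A

lemma cons_mem_admissiblePaths {key : W → W → K} {r : ℕ} {A : Finset W} {v w : W} (hv : v ∉ A)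
    (hw : w ∈ A) (hvw : G.Adj v w) {p : Fin (r + 1) → W}
    (hp : p ∈ admissiblePaths G key r (pruned G key A v w) w) :
    (Fin.cons v p : Fin (r + 2) → W) ∈ admissiblePaths G key (r + 1) A v := by
  simp only [admissiblePaths, Finset.mem_filter, Finset.mem_univ, true_and] at hp ⊢
  obtain ⟨hp0, ⟨hinj, hadj, hnon⟩, hmem⟩ := hp
  have hmemA : ∀ j, p j ∈ A := by
    intro j
    refine Fin.cases (hp0 ▸ hw) (fun j => ?_) j
    exact (Finset.mem_filter.1 (hmem j)).1
  refine ⟨rfl, ⟨?_, ?_, ?_⟩, ?_⟩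
  · refine Fin.cons_injective_iff.2 ⟨?_, hinj⟩
    rintro ⟨j, rfl⟩
    exact hv (hmemA j)
  · intro j
    refine Fin.cases ?_ (fun j => ?_) j
    · simpa [hp0] using hvw
    · simpa using hadj j
  · intro i j
    refine Fin.cases ?_ (fun j => ?_) j
    · intro h; exact absurd h (Fin.not_lt_zero _)
    refine Fin.cases ?_ (fun i => ?_) i
    · intro _ hlt hA
      have h := (Finset.mem_filter.1 (hmem j)).2
      simp only [Fin.castSucc_zero, Fin.cons_zero, Fin.cons_succ, hp0] at hlt hA
      exact h ⟨hA, hlt.le⟩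
    · intro hij
      simpa using hnon i j (by simpa using hij)
  · intro j
    simpa using hmemA j

/-- The walks of the recursion are admissible paths; the first step of a path determines the pruned
set in which the rest of it runs. -/
lemma walkCount_le_card (key : W → W → K) (r : ℕ) (A : Finset W) (v : W) (hv : v ∉ A) :
    walkCount G key r A v ≤ (admissiblePaths G key r A v).card := by
  induction r generalizing A v with
  | zero =>
    rw [walkCount, Nat.one_le_iff_ne_zero, Finset.card_ne_zero]
    refine ⟨fun _ => v, Finset.mem_filter.2 ⟨Finset.mem_univ _, rfl, ⟨?_, ?_, ?_⟩, ?_⟩⟩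
    · intro i j _; exact Subsingleton.elim (α := Fin 1) i j
    all_goals exact fun i => i.elim0
  | succ r ih =>
    have hmaps : Set.MapsTo (fun p : Fin (r + 2) → W => p 1)
        (admissiblePaths G key (r + 1) A v : Set (Fin (r + 2) → W))
        (A.filter (fun w => G.Adj v w) : Finset W) := by
      intro p hp
      obtain ⟨hp0, ⟨-, hadj, -⟩, hmem⟩ := (Finset.mem_filter.1 hp).2
      refine Finset.mem_coe.2 (Finset.mem_filter.2 ⟨hmem 0, ?_⟩)
      have := hadj 0
      rwa [Fin.castSucc_zero, hp0] at this
    rw [Finset.card_eq_sum_card_fiberwise hmaps, walkCount]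
    refine Finset.sum_le_sum fun w hw => ?_
    obtain ⟨hwA, hvw⟩ := Finset.mem_filter.1 hw
    refine (ih _ _ (by simp [pruned, hvw])).trans ?_
    refine Finset.card_le_card_of_injOn (fun p => (Fin.cons v p : Fin (r + 2) → W)) ?_ ?_
    · intro p hp
      refine Finset.mem_coe.2 (Finset.mem_filter.2 ⟨cons_mem_admissiblePaths hv hwA hvw hp, ?_⟩)
      exact (Finset.mem_filter.1 hp).2.1
    · intro p _ q _ h
      exact Fin.cons_right_injective (α := fun _ => W) v h

lemma walkCount_le_card_univ (key : W → W → K) (r : ℕ) (A : Finset W) (v : W) (hv : v ∉ A) :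
    walkCount G key r A v ≤ (Finset.univ.filter fun p : Fin (r + 1) → W =>
      p 0 = v ∧ IsAdmissible G key r p).card := by
  refine (walkCount_le_card key r A v hv).trans (Finset.card_le_card fun p hp => ?_)
  simp only [admissiblePaths, Finset.mem_filter, Finset.mem_univ, true_and] at hp ⊢
  exact ⟨hp.1, hp.2.1⟩

end Paths

/-! ### Path integrals -/

section PathIntegral

lemma expNeg_le_one (a : ℝ≥0∞) : expNeg a ≤ 1 := by
  rw [expNeg, EReal.exp_le_one_iff, EReal.neg_le_zero]
  exact EReal.coe_ennreal_nonneg a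

lemma expNeg_zero : expNeg 0 = 1 := by simp [expNeg]

lemma expNeg_add (a b : ℝ≥0∞) : expNeg (a + b) = expNeg a * expNeg b := by
  rw [expNeg, expNeg, expNeg, ← EReal.exp_add, EReal.coe_ennreal_add,
    EReal.neg_add (by simp) (by simp), sub_eq_add_neg]

lemma expNeg_sum {ι : Type*} (s : Finset ι) (f : ι → ℝ≥0∞) :
    expNeg (∑ i ∈ s, f i) = ∏ i ∈ s, expNeg (f i) := by
  classical
  induction s using Finset.induction_on with
  | empty => simp [expNeg_zero]
  | insert a s ha ih => rw [Finset.sum_insert ha, Finset.prod_insert ha, expNeg_add, ih]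

lemma measurable_expNeg : Measurable expNeg :=
  EReal.measurable_exp.comp measurable_coe_ennreal_ereal.neg

open Classical in
/-- The weight of the constraint that a path which has moved from `a` to `b` imposes on a later
vertex `c`. -/
def constraintWeight {X : Type*} [MetricSpace X] (φ : X → X → ℝ≥0∞) (a b c : X) : ℝ≥0∞ :=
  if dist a c < dist a b then expNeg (φ a c) else 1

lemma measurePreserving_append {X : Type*} [MeasurableSpace X] (ν : Measure X) [SigmaFinite ν]
    (k l : ℕ) :
    MeasurePreserving (fun p : (Fin k → X) × (Fin l → X) => Fin.append p.1 p.2)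
      ((Measure.pi fun _ => ν).prod (Measure.pi fun _ => ν)) (Measure.pi fun _ => ν) := by
  have hm : Measurable fun p : (Fin k → X) × (Fin l → X) => Fin.append p.1 p.2 := by
    refine measurable_pi_iff.2 fun i => ?_
    refine Fin.addCases (fun i => ?_) (fun i => ?_) i
    · simpa using! (measurable_pi_apply i).comp measurable_fst
    · simpa using! (measurable_pi_apply i).comp measurable_snd
  refine ⟨hm, (Measure.pi_eq fun s hs => ?_).symm⟩
  have hpre : (fun p : (Fin k → X) × (Fin l → X) => Fin.append p.1 p.2) ⁻¹' Set.univ.pi s =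
      (Set.univ.pi fun i => s (Fin.castAdd l i)) ×ˢ (Set.univ.pi fun i => s (Fin.natAdd k i)) := by
    ext p
    simp only [Set.mem_preimage, Set.mem_pi, Set.mem_univ, true_implies, Set.mem_prod]
    constructor
    · intro h
      exact ⟨fun i => by simpa using h (Fin.castAdd l i), fun i => by simpa using h (Fin.natAdd k i)⟩
    · rintro ⟨h1, h2⟩ i
      refine Fin.addCases (fun i => ?_) (fun i => ?_) i
      · simpa using h1 i
      · simpa using h2 i
  rw [Measure.map_apply hm (MeasurableSet.univ_pi hs), hpre, Measure.prod_prod, Measure.pi_pi,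
    Measure.pi_pi, Fin.prod_univ_add]

/-- A submultiplicative sequence of finite numbers with a term below `1` is summable. -/
lemma tsum_ne_top_of_submultiplicative {a : ℕ → ℝ≥0∞} (hmul : ∀ k l, a (k + l) ≤ a k * a l)
    (hfin : ∀ k, a k ≠ ∞) {k : ℕ} (hk : k ≠ 0) (hlt : a k < 1) : ∑' j, a j ≠ ∞ := by
  have : NeZero k := ⟨hk⟩
  have hpow : ∀ m r, a (k * m + r) ≤ a k ^ m * a r := by
    intro m r
    induction m with
    | zero => simp
    | succ m ih =>
      calc a (k * (m + 1) + r) = a (k + (k * m + r)) := by congr 1; ring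
        _ ≤ a k * a (k * m + r) := hmul _ _
        _ ≤ a k * (a k ^ m * a r) := by gcongr
        _ = _ := by ring
  have h1 : ∑' j, a j ≤ ∑' p : ℕ × Fin k, a k ^ p.1 * a p.2 := by
    rw [← (Nat.divModEquiv k).symm.tsum_eq]
    refine ENNReal.tsum_le_tsum fun p => ?_
    have : (Nat.divModEquiv k).symm p = k * p.1 + p.2 := by
      simp [Nat.divModEquiv, mul_comm]
    rw [this]
    exact hpow _ _
  refine ne_top_of_le_ne_top ?_ h1
  rw [ENNReal.tsum_prod (f := fun (m : ℕ) (r : Fin k) => a k ^ m * a r)]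
  simp only [ENNReal.tsum_mul_left, ENNReal.tsum_mul_right, ENNReal.tsum_geometric]
  refine ENNReal.mul_ne_top ?_ ?_
  · rw [Ne, ENNReal.inv_eq_top, tsub_eq_zero_iff_le, not_le]
    exact hlt
  · rw [tsum_fintype]
    exact ENNReal.sum_ne_top.2 fun _ _ => hfin _

variable {X : Type*} [MetricSpace X]

lemma constraintWeight_le_one (φ : X → X → ℝ≥0∞) (a b c : X) : constraintWeight φ a b c ≤ 1 := by
  unfold constraintWeight
  split_ifs
  · exact expNeg_le_one _
  · exact le_rfl

lemma pathWeight_eq_prod (φ : X → X → ℝ≥0∞) (k : ℕ) (y : Fin (k + 1) → X) :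
    pathWeight φ k y = ∏ j : Fin k,
      (∏ i : Fin k, if i < j then
          constraintWeight φ (y i.castSucc) (y i.succ) (y j.succ) else 1) *
        (1 - expNeg (φ (y j.castSucc) (y j.succ))) := by
  unfold pathWeight
  refine Finset.prod_congr rfl fun j _ => ?_
  congr 1
  rw [expNeg_sum, Finset.prod_filter]
  refine Finset.prod_congr rfl fun i _ => ?_
  unfold constraintWeight
  split_ifs <;> simp [expNeg_zero]

/-- Dropping the constraints between the two halves of a path can only increase its weight. -/
lemma pathWeight_add_le (φ : X → X → ℝ≥0∞) (k l : ℕ) (y : Fin (k + l + 1) → X) :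
    pathWeight φ (k + l) y ≤
      pathWeight φ k (fun i => y ⟨i, by omega⟩) * pathWeight φ l (fun i => y ⟨k + i, by omega⟩) := by
  simp only [pathWeight_eq_prod]
  rw [Fin.prod_univ_add]
  refine mul_le_mul' (Finset.prod_le_prod' fun j _ => ?_) (Finset.prod_le_prod' fun j _ => ?_)
  · refine mul_le_mul' ?_ le_rfl
    rw [Fin.prod_univ_add]
    refine (mul_le_of_le_one_right' (Finset.prod_le_one' fun i _ => ?_)).trans
      (Finset.prod_le_prod' fun i _ => ?_)
    · split_ifs
      · exact constraintWeight_le_one _ _ _ _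
      · exact le_rfl
    · exact le_of_eq rfl
  · refine mul_le_mul' ?_ (le_of_eq rfl)
    rw [Fin.prod_univ_add]
    refine (mul_le_of_le_one_left' (Finset.prod_le_one' fun i _ => ?_)).trans
      (Finset.prod_le_prod' fun i _ => ?_)
    · split_ifs
      · exact constraintWeight_le_one _ _ _ _
      · exact le_rfl
    · simp only [Fin.lt_def, Fin.val_natAdd, add_lt_add_iff_left]
      exact le_of_eq rfl

variable [MeasurableSpace X]

lemma lintegral_pathWeight_le (ν : Measure X) (φ : X → X → ℝ≥0∞) (k : ℕ) (x₀ : X) :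
    ∫⁻ x : Fin k → X, pathWeight φ k (Fin.cons x₀ x) ∂(Measure.pi fun _ => ν) ≤
      pathIntegral ν φ k := by
  unfold pathIntegral
  split_ifs with h
  · subst h
    simp [pathWeight]
  · exact le_iSup (fun x₀ : X =>
      ∫⁻ x : Fin k → X, pathWeight φ k (Fin.cons x₀ x) ∂(Measure.pi fun _ => ν)) x₀

lemma pathIntegral_one (ν : Measure X) [SigmaFinite ν] (φ : X → X → ℝ≥0∞)
    (hφ : Measurable (Function.uncurry φ)) : pathIntegral ν φ 1 = temperedness ν φ := by
  rw [pathIntegral, if_neg one_ne_zero, temperedness]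
  refine iSup_congr fun x => ?_
  have hm : Measurable fun y => 1 - expNeg (φ x y) :=
    measurable_const.sub (measurable_expNeg.comp (hφ.comp measurable_prodMk_left))
  rw [← (measurePreserving_funUnique ν (Fin 1)).lintegral_comp hm]
  refine lintegral_congr fun y => ?_
  rw [pathWeight_eq_prod]
  simp

variable [BorelSpace X] [SecondCountableTopology X]

lemma measurable_pathWeight {φ : X → X → ℝ≥0∞} (hφ : Measurable (Function.uncurry φ)) (k : ℕ) :
    Measurable (pathWeight φ k) := by
  have h : ∀ a b : Fin (k + 1), Measurable fun y : Fin (k + 1) → X => φ (y a) (y b) := fun a b =>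
    hφ.comp (g := Function.uncurry φ) (f := fun y : Fin (k + 1) → X => (y a, y b))
      ((measurable_pi_apply a).prodMk (measurable_pi_apply b))
  have hd : ∀ a b : Fin (k + 1), Measurable fun y : Fin (k + 1) → X => dist (y a) (y b) :=
    fun a b => (measurable_pi_apply a).dist (measurable_pi_apply b)
  have e : pathWeight φ k = _ := funext fun y => pathWeight_eq_prod φ k y
  rw [e]
  refine Finset.measurable_fun_prod _ fun j _ => Measurable.mul
    (Finset.measurable_fun_prod _ fun i _ => ?_) ?_
  · split_ifs
    · exact Measurable.ite (measurableSet_lt (hd _ _) (hd _ _)) (measurable_expNeg.comp (h _ _))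
        measurable_const
    · exact measurable_const
  · exact measurable_const.sub (measurable_expNeg.comp (h _ _))

/-- The path integrals are submultiplicative: the second half of a path is integrated first, with the
end point of the first half as its starting point. -/
lemma pathIntegral_add_le (ν : Measure X) [SigmaFinite ν] {φ : X → X → ℝ≥0∞}
    (hφ : Measurable (Function.uncurry φ)) (k l : ℕ) :
    pathIntegral ν φ (k + l) ≤ pathIntegral ν φ k * pathIntegral ν φ l := by
  rcases Nat.eq_zero_or_pos (k + l) with h0 | h0
  · obtain ⟨rfl, rfl⟩ : k = 0 ∧ l = 0 := by omega
    simp [pathIntegral]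
  conv_lhs => rw [pathIntegral, if_neg h0.ne']
  refine iSup_le fun x₀ => ?_
  have hm : ∀ (m : ℕ) (x₀ : X),
      Measurable fun x : Fin m → X => pathWeight φ m (Fin.cons x₀ x) := by
    intro m x₀
    refine (measurable_pathWeight hφ m).comp (measurable_pi_iff.2 fun i => ?_)
    refine Fin.cases ?_ (fun i => ?_) i
    · simp
    · simpa using measurable_pi_apply i
  rw [← (measurePreserving_append ν k l).lintegral_comp
    (f := fun x => pathWeight φ (k + l) (Fin.cons x₀ x))
    (hm _ _), lintegral_prod
    (fun p : (Fin k → X) × (Fin l → X) =>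
      pathWeight φ (k + l) (Fin.cons x₀ (Fin.append p.1 p.2)))
    ((hm _ _).comp
      (measurePreserving_append ν k l).measurable).aemeasurable]
  calc _ ≤ ∫⁻ a : Fin k → X, (pathWeight φ k (Fin.cons x₀ a) * pathIntegral ν φ l)
          ∂(Measure.pi fun _ => ν) := by
        refine lintegral_mono fun a => ?_
        refine le_trans ?_ (mul_le_mul_right (lintegral_pathWeight_le ν φ l
          ((Fin.cons x₀ a : Fin (k + 1) → X) (Fin.last k))) _)
        rw [← lintegral_const_mul _ (hm l _)]
        refine lintegral_mono fun b => ?_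
        refine (pathWeight_add_le φ k l _).trans (le_of_eq ?_)
        congr 2
        · funext i
          refine Fin.cases rfl (fun i => ?_) i
          exact Fin.append_left a b i
        · funext i
          refine Fin.cases ?_ (fun i => ?_) i
          · rcases k with _ | k
            · rfl
            · exact Fin.append_left a b (Fin.last k)
          · exact Fin.append_right a b i
    _ = (∫⁻ a : Fin k → X, pathWeight φ k (Fin.cons x₀ a) ∂(Measure.pi fun _ => ν)) *
          pathIntegral ν φ l :=
        lintegral_mul_const _ (hm k _)
    _ ≤ _ := mul_le_mul_left (lintegral_pathWeight_le ν φ k x₀) _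

/-- Below the threshold `e / Δ_φ` there is a radius `1 / D` at which the series of the path integrals
converges and for which `λ D < e` still holds. -/
lemma exists_tsum_pathIntegral_ne_top (ν : Measure X) [SigmaFinite ν] {φ : X → X → ℝ≥0∞}
    (hφ : Measurable (Function.uncurry φ)) (hC : temperedness ν φ < ∞) (lam : ℝ≥0)
    (hlam : (lam : ℝ≥0∞) < ENNReal.ofReal (Real.exp 1) / pwcc ν φ) :
    ∃ D : ℝ≥0, 0 < D ∧ (lam * D : ℝ) < Real.exp 1 ∧
      ∑' k, pathIntegral ν φ k * ((D : ℝ≥0∞)⁻¹) ^ k ≠ ∞ := by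
  have he : ENNReal.ofReal (Real.exp 1) ≠ 0 := by
    simp [Real.exp_pos]
  have hfin : ∀ k, pathIntegral ν φ k ≠ ∞ := by
    intro k
    induction k with
    | zero => simp [pathIntegral]
    | succ k ih =>
      refine ne_top_of_le_ne_top (ENNReal.mul_ne_top ih ?_) (pathIntegral_add_le ν hφ k 1)
      rw [pathIntegral_one ν φ hφ]
      exact hC.ne
  have hΔ : pwcc ν φ < ∞ := by
    refine lt_of_le_of_lt (iInf_le _ ⟨1, le_rfl⟩) ?_
    simpa using (hfin 1).lt_top
  have h1 : pwcc ν φ < ENNReal.ofReal (Real.exp 1) / lam := by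
    rcases eq_or_ne lam 0 with rfl | h0
    · rw [ENNReal.coe_zero, ENNReal.div_zero he]
      exact hΔ
    · rw [ENNReal.lt_div_iff_mul_lt (by simp [h0]) (by simp), mul_comm]
      exact ENNReal.mul_lt_of_lt_div hlam
  obtain ⟨D, hD1, hD2⟩ := exists_between h1
  lift D to ℝ≥0 using hD2.ne_top
  have hD0 : 0 < D := by exact_mod_cast lt_of_le_of_lt zero_le hD1
  refine ⟨D, hD0, ?_, ?_⟩
  · have h2 : (lam : ℝ≥0∞) * D < ENNReal.ofReal (Real.exp 1) := ENNReal.mul_lt_of_lt_div' hD2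
    rw [ENNReal.lt_ofReal_iff_toReal_lt (ENNReal.mul_ne_top (by simp) (by simp))] at h2
    simpa using h2
  · obtain ⟨⟨k, hk⟩, hlt⟩ := iInf_lt_iff.1 hD1
    have hk0 : (0 : ℝ) < k := by exact_mod_cast hk
    have hVk : pathIntegral ν φ k < (D : ℝ≥0∞) ^ k := by
      have := ENNReal.rpow_lt_rpow hlt hk0
      rwa [← ENNReal.rpow_mul, one_div_mul_cancel hk0.ne', ENNReal.rpow_one,
        ENNReal.rpow_natCast] at this
    have hDne : (D : ℝ≥0∞) ≠ 0 := by simp [hD0.ne']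
    refine tsum_ne_top_of_submultiplicative (k := k) (fun i j => ?_) (fun i => ?_) (by omega) ?_
    · calc _ ≤ (pathIntegral ν φ i * pathIntegral ν φ j) * ((D : ℝ≥0∞)⁻¹) ^ (i + j) := by
            gcongr
            exact pathIntegral_add_le ν hφ i j
        _ = _ := by ring
    · exact ENNReal.mul_ne_top (hfin i) (ENNReal.pow_ne_top (by simp [hD0.ne']))
    · rw [← ENNReal.inv_pow, ← div_eq_mul_inv]
      exact ENNReal.div_lt_of_lt_mul (by simpa using hVk)

end PathIntegral

/-! ### Paths in the random graph -/

section RandomGraphPaths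

open scoped Classical

/-- Independent bits with the laws `f p` take prescribed values `h i` at distinct places `e i` with
the product of the individual probabilities. -/
lemma sum_prod_of_forall_eq {P ι : Type*} [Fintype P] [DecidableEq P] (f : P → Bool → ℝ≥0∞)
    (hf : ∀ p, ∑ b, f p b = 1) (I : Finset ι) {e : ι → P} (he : Function.Injective e)
    (h : ι → Bool) :
    ∑ ω ∈ Finset.univ.filter (fun ω : P → Bool => ∀ i ∈ I, ω (e i) = h i), ∏ p, f p (ω p) =
      ∏ i ∈ I, f (e i) (h i) := by
  have h1 : Finset.univ.filter (fun ω : P → Bool => ∀ i ∈ I, ω (e i) = h i) =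
      Fintype.piFinset fun p => Finset.univ.filter fun b => ∀ i ∈ I, e i = p → b = h i := by
    ext ω
    simp only [Finset.mem_filter, Finset.mem_univ, true_and, Fintype.mem_piFinset]
    exact ⟨fun H p i hi hp => hp ▸ H i hi, fun H i hi => H (e i) i hi rfl⟩
  rw [h1, ← Finset.prod_univ_sum, ← Finset.prod_subset (Finset.subset_univ (I.image e)),
    Finset.prod_image he.injOn]
  · refine Finset.prod_congr rfl fun i hi => ?_
    have : (Finset.univ.filter fun b => ∀ j ∈ I, e j = e i → b = h j) = {h i} := by
      ext b
      simp only [Finset.mem_filter, Finset.mem_univ, true_and, Finset.mem_singleton]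
      exact ⟨fun H => H i hi rfl, fun H j _ hj => he hj ▸ H⟩
    rw [this, Finset.sum_singleton]
  · intro p _ hp
    rw [Finset.filter_true_of_mem, hf]
    intro b _ i hi hip
    exact absurd (Finset.mem_image.2 ⟨i, hi, hip⟩) hp

variable {n : ℕ}

/-- The unordered pairs of distinct vertices, represented by their increasing enumeration. -/
abbrev VertexPair (n : ℕ) : Type := {p : Fin n × Fin n // p.1 < p.2}

/-- The vertex pair formed by two distinct vertices. -/
def vertexPair (a b : Fin n) (h : a ≠ b) : VertexPair n :=
  if hab : a < b then ⟨(a, b), hab⟩ else ⟨(b, a), lt_of_le_of_ne (not_lt.1 hab) h.symm⟩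

lemma vertexPair_eq_iff {a b c d : Fin n} {h : a ≠ b} {h' : c ≠ d} :
    vertexPair a b h = vertexPair c d h' ↔ (a = c ∧ b = d) ∨ (a = d ∧ b = c) := by
  unfold vertexPair
  split_ifs <;> simp only [Subtype.mk.injEq, Prod.mk.injEq] <;> grind

/-- A graph as the family of the indicators of its edges. -/
def graphEquiv (n : ℕ) : SimpleGraph (Fin n) ≃ (VertexPair n → Bool) where
  toFun G p := decide (G.Adj p.1.1 p.1.2)
  invFun ω :=
    { Adj := fun a b => ∃ h : a ≠ b, ω (vertexPair a b h) = true
      symm := ⟨by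
        rintro a b ⟨h, hω⟩
        refine ⟨h.symm, ?_⟩
        rwa [show vertexPair b a h.symm = vertexPair a b h from vertexPair_eq_iff.2 (by simp)]⟩
      loopless := ⟨fun a ⟨h, _⟩ => h rfl⟩ }
  left_inv G := by
    ext a b
    simp only [vertexPair]
    constructor
    · rintro ⟨h, hω⟩
      split_ifs at hω
      · simpa using hω
      · exact SimpleGraph.Adj.symm (by simpa using hω)
    · intro h
      refine ⟨h.ne, ?_⟩
      split_ifs
      · simpa using h
      · simpa using h.symm
  right_inv ω := by
    funext ⟨p, hp⟩
    rw [Bool.eq_iff_iff]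
    simp [vertexPair, hp, hp.ne]

lemma graphEquiv_vertexPair (G : SimpleGraph (Fin n)) {a b : Fin n} (h : a ≠ b) :
    graphEquiv n G (vertexPair a b h) = decide (G.Adj a b) := by
  unfold vertexPair
  split_ifs
  · rfl
  · simp [graphEquiv, G.adj_comm]

variable {X : Type*}

/-- The probability of the graph `G` when the positions are `x`. -/
def graphWeight (φ : X → X → ℝ≥0∞) (x : Fin n → X) (G : SimpleGraph (Fin n)) : ℝ≥0∞ :=
  ∏ p ∈ Finset.univ.filter (fun p : Fin n × Fin n => p.1 < p.2),
    (if G.Adj p.1 p.2 then 1 - expNeg (φ (x p.1) (x p.2))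
      else 1 - (1 - expNeg (φ (x p.1) (x p.2))))

/-- The law of the indicator of the edge `p` when the positions are `x`. -/
def edgeLaw (φ : X → X → ℝ≥0∞) (x : Fin n → X) (p : VertexPair n) (b : Bool) : ℝ≥0∞ :=
  if b = true then 1 - expNeg (φ (x p.1.1) (x p.1.2)) else expNeg (φ (x p.1.1) (x p.1.2))

lemma sum_edgeLaw (φ : X → X → ℝ≥0∞) (x : Fin n → X) (p : VertexPair n) :
    ∑ b, edgeLaw φ x p b = 1 := by
  simp [edgeLaw, tsub_add_cancel_of_le (expNeg_le_one _)]

lemma edgeLaw_vertexPair {φ : X → X → ℝ≥0∞} (hφ : ∀ x y, φ x y = φ y x) (x : Fin n → X)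
    {a b : Fin n} (h : a ≠ b) (c : Bool) :
    edgeLaw φ x (vertexPair a b h) c =
      if c = true then 1 - expNeg (φ (x a) (x b)) else expNeg (φ (x a) (x b)) := by
  unfold vertexPair
  split_ifs with h1 h2 <;> simp_all [edgeLaw, hφ (x b) (x a)]

lemma graphWeight_eq_prod (φ : X → X → ℝ≥0∞) (x : Fin n → X) (G : SimpleGraph (Fin n)) :
    graphWeight φ x G = ∏ p, edgeLaw φ x p (graphEquiv n G p) := by
  rw [graphWeight, Finset.prod_subtype (p := fun p : Fin n × Fin n => p.1 < p.2) _ (by simp)]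
  refine Finset.prod_congr rfl fun p _ => ?_
  rw [ENNReal.sub_sub_cancel ENNReal.one_ne_top (expNeg_le_one _)]
  simp [edgeLaw, graphEquiv]

/-- The probability of an event that prescribes the indicators of distinct edges `e i`, given the
positions. -/
lemma sum_graphWeight_filter_le (φ : X → X → ℝ≥0∞) (x : Fin n → X) {ι : Type*} (I : Finset ι)
    {e : ι → VertexPair n} (he : Function.Injective e) (h : ι → Bool)
    (Q : SimpleGraph (Fin n) → Prop) (hQ : ∀ G, Q G → ∀ i ∈ I, graphEquiv n G (e i) = h i) :
    ∑ G ∈ Finset.univ.filter Q, graphWeight φ x G ≤ ∏ i ∈ I, edgeLaw φ x (e i) (h i) := by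
  rw [← sum_prod_of_forall_eq _ (sum_edgeLaw φ x) I he h]
  refine (Finset.sum_le_sum_of_subset (t := Finset.univ.filter fun G =>
    ∀ i ∈ I, graphEquiv n G (e i) = h i) fun G hG => ?_).trans (le_of_eq ?_)
  · simp only [Finset.mem_filter, Finset.mem_univ, true_and] at hG ⊢
    exact hQ G hG
  · refine Finset.sum_equiv (graphEquiv n) (by simp) fun G _ => graphWeight_eq_prod φ x G

lemma sum_graphWeight (φ : X → X → ℝ≥0∞) (x : Fin n → X) : ∑ G, graphWeight φ x G = 1 := by
  rw [Fintype.sum_equiv (graphEquiv n) _ (fun ω => ∏ p, edgeLaw φ x p (ω p))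
    (graphWeight_eq_prod φ x)]
  rw [← Fintype.prod_sum]
  simp only [sum_edgeLaw, Finset.prod_const_one]

variable [MetricSpace X]

/-- Each vertex orders the others by their distance, with ties broken by their labels. -/
def distKey (x : Fin n → X) (a b : Fin n) : ℝ ×ₗ Fin n := toLex (dist (x a) (x b), b)

lemma distKey_injective (x : Fin n → X) (a : Fin n) : Function.Injective (distKey x a) := by
  intro b c h
  exact congrArg (fun q : ℝ ×ₗ Fin n => (ofLex q).2) h

/-- Given the positions, a path is admissible with probability at most its path weight. -/
lemma sum_graphWeight_isAdmissible_le {φ : X → X → ℝ≥0∞} (hφ : ∀ x y, φ x y = φ y x)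
    (x : Fin n → X) (r : ℕ) (p : Fin (r + 1) → Fin n) (hp : Function.Injective p) :
    ∑ G ∈ Finset.univ.filter (fun G => IsAdmissible G (distKey x) r p), graphWeight φ x G ≤
      pathWeight φ r fun i => x (p i) := by
  -- The index `(i, j)` with `i ≤ j` stands for the pair of the path vertices `i` and `j + 1`: an edge
  -- of the path if `i = j`, and a pair that may be constrained to be a non-edge if `i < j`.
  have hne : ∀ q : {q : Fin r × Fin r // q.1 ≤ q.2}, p q.1.1.castSucc ≠ p q.1.2.succ := by
    intro q h
    have h1 := congrArg Fin.val (hp h)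
    have h2 := q.2
    simp only [Fin.le_def] at h2
    simp only [Fin.val_castSucc, Fin.val_succ] at h1
    omega
  set e : {q : Fin r × Fin r // q.1 ≤ q.2} → VertexPair n := fun q => vertexPair _ _ (hne q) with he
  have heinj : Function.Injective e := by
    rintro ⟨⟨i, j⟩, hij⟩ ⟨⟨i', j'⟩, hij'⟩ h
    simp only [he, vertexPair_eq_iff, hp.eq_iff, Fin.ext_iff, Fin.val_castSucc, Fin.val_succ] at h
    simp only [Fin.le_def] at hij hij'
    simp only [Subtype.mk.injEq, Prod.mk.injEq, Fin.ext_iff]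
    omega
  set I : Finset {q : Fin r × Fin r // q.1 ≤ q.2} := Finset.univ.filter fun q => q.1.1 = q.1.2 ∨
    dist (x (p q.1.1.castSucc)) (x (p q.1.2.succ)) <
      dist (x (p q.1.1.castSucc)) (x (p q.1.1.succ)) with hI
  refine (sum_graphWeight_filter_le φ x I heinj (fun q => decide (q.1.1 = q.1.2)) _ ?_).trans
    (le_of_eq ?_)
  · rintro G ⟨-, hadj, hnon⟩ ⟨⟨i, j⟩, hij⟩ hq
    rw [he, graphEquiv_vertexPair]
    simp only [hI, Finset.mem_filter, Finset.mem_univ, true_and] at hq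
    rcases eq_or_ne i j with rfl | hne'
    · simpa using hadj i
    · have := hnon i j (lt_of_le_of_ne hij hne') ?_
      · simpa [hne'] using this
      · exact Prod.Lex.toLex_lt_toLex.2 (Or.inl (hq.resolve_left hne'))
  · set F : Fin r × Fin r → ℝ≥0∞ := fun q =>
      if q.1 = q.2 then 1 - expNeg (φ (x (p q.2.castSucc)) (x (p q.2.succ)))
      else constraintWeight φ (x (p q.1.castSucc)) (x (p q.1.succ)) (x (p q.2.succ)) with hF
    calc ∏ q ∈ I, edgeLaw φ x (e q) (decide (q.1.1 = q.1.2))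
        = ∏ q : {q : Fin r × Fin r // q.1 ≤ q.2}, F q := by
          rw [hI, Finset.prod_filter]
          refine Finset.prod_congr rfl fun q _ => ?_
          simp only [he, hF, edgeLaw_vertexPair hφ, constraintWeight]
          by_cases h : q.1.1 = q.1.2
          · simp [h]
          · simp [h]
      _ = ∏ q : Fin r × Fin r, if q.1 ≤ q.2 then F q else 1 := by
          rw [← Finset.prod_filter]
          exact (Finset.prod_subtype _ (by simp) F).symm
      _ = ∏ j : Fin r, ∏ i : Fin r, if i ≤ j then F (i, j) else 1 := by
          rw [Fintype.prod_prod_type, Finset.prod_comm]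
      _ = _ := by
          rw [pathWeight_eq_prod]
          refine Finset.prod_congr rfl fun j _ => ?_
          rw [show 1 - expNeg (φ (x (p j.castSucc)) (x (p j.succ))) =
            ∏ i : Fin r, if i = j then 1 - expNeg (φ (x (p j.castSucc)) (x (p j.succ))) else 1 by
              simp, ← Finset.prod_mul_distrib]
          refine Finset.prod_congr rfl fun i _ => ?_
          rcases lt_trichotomy i j with h | h | h
          · simp [hF, h, h.le, h.ne]
          · simp [hF, h]
          · simp [h.not_ge, h.not_gt, h.ne']

end RandomGraphPaths

/-! ### The expected number of admissible paths -/

section Expectation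

open scoped Classical

/-- Distinct coordinates of an i.i.d. family form an i.i.d. family. -/
lemma measurePreserving_comp_injective {X ι κ : Type*} [Fintype ι] [Fintype κ] [MeasurableSpace X]
    (ξ : Measure X) [IsProbabilityMeasure ξ] {p : κ → ι} (hp : Function.Injective p) :
    MeasurePreserving (fun (x : ι → X) i => x (p i)) (Measure.pi fun _ => ξ)
      (Measure.pi fun _ => ξ) := by
  have hm : Measurable fun (x : ι → X) i => x (p i) :=
    measurable_pi_iff.2 fun i => measurable_pi_apply _
  refine ⟨hm, (Measure.pi_eq fun s hs => ?_).symm⟩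
  have hpre : (fun (x : ι → X) i => x (p i)) ⁻¹' Set.univ.pi s =
      Set.univ.pi (Function.extend p s fun _ => Set.univ) := by
    ext x
    simp only [Set.mem_preimage, Set.mem_pi, Set.mem_univ, true_implies]
    constructor
    · intro h a
      by_cases ha : ∃ i, p i = a
      · obtain ⟨i, rfl⟩ := ha
        rw [hp.extend_apply]
        exact h i
      · rw [Function.extend_apply' _ _ _ ha]
        trivial
    · intro h i
      simpa only [hp.extend_apply] using h (p i)
  rw [Measure.map_apply hm (MeasurableSet.univ_pi hs), hpre, Measure.pi_pi]
  refine (Fintype.prod_of_injective p hp _ _ (fun a ha => ?_) fun i => ?_).symm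
  · rw [Function.extend_apply' _ _ _ ha]
    exact measure_univ
  · rw [hp.extend_apply]

variable {X : Type*} [MeasurableSpace X]

/-- The joint law of independent uniform points of `V`. -/
lemma pi_cond_eq (ν : Measure X) [SigmaFinite ν] {V : Set X} (hV : MeasurableSet V)
    [IsProbabilityMeasure (ProbabilityTheory.cond ν V)] (r : ℕ) :
    (Measure.pi fun _ : Fin r => ProbabilityTheory.cond ν V) =
      (ν V)⁻¹ ^ r • (Measure.pi fun _ : Fin r => ν).restrict (Set.univ.pi fun _ => V) := by
  refine Measure.pi_eq fun s hs => ?_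
  rw [Measure.smul_apply, Measure.restrict_apply (MeasurableSet.univ_pi hs), ← Set.pi_inter_distrib,
    Measure.pi_pi, smul_eq_mul]
  simp only [ProbabilityTheory.cond_apply hV, Finset.prod_mul_distrib, Finset.prod_const,
    Finset.card_univ, Fintype.card_fin, Set.inter_comm]

/-- Markov's inequality for the random graph: `F` is likely if it contains all graphs on which some
statistic `Z` of the positions and the graph is below `t`. -/
lemma one_sub_le_randomGraphProb (ν : Measure X) {V : Set X}
    [IsProbabilityMeasure (ProbabilityTheory.cond ν V)]
    {φ : X → X → ℝ≥0∞} (hφ : Measurable (Function.uncurry φ)) {n : ℕ}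
    (F : Set (SimpleGraph (Fin n))) (Z : (Fin n → X) → SimpleGraph (Fin n) → ℝ≥0∞) {t ε : ℝ≥0∞}
    (ht : t ≠ 0) (ht' : t ≠ ∞) (hF : ∀ x G, Z x G < t → G ∈ F)
    (hZ : ∑ G, ∫⁻ x : Fin n → X, graphWeight φ x G * Z x G
        ∂(Measure.pi fun _ => ProbabilityTheory.cond ν V) ≤ t * ε) :
    1 - ε ≤ randomGraphProb ν V φ n F := by
  set ξ := ProbabilityTheory.cond ν V with hξ
  have hprob : ∀ F : Set (SimpleGraph (Fin n)), randomGraphProb ν V φ n F =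
      ∑ G ∈ Finset.univ.filter (fun G => G ∈ F),
        ∫⁻ x : Fin n → X, graphWeight φ x G ∂(Measure.pi fun _ => ξ) := fun F => rfl
  have hmeas : ∀ G : SimpleGraph (Fin n), Measurable fun x : Fin n → X => graphWeight φ x G := by
    intro G
    have h : ∀ a b : Fin n, Measurable fun x : Fin n → X => 1 - expNeg (φ (x a) (x b)) :=
      fun a b => measurable_const.sub (measurable_expNeg.comp
        (hφ.comp (g := Function.uncurry φ) (f := fun x : Fin n → X => (x a, x b))
          ((measurable_pi_apply a).prodMk (measurable_pi_apply b))))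
    refine Finset.measurable_fun_prod _ fun p _ => ?_
    split_ifs
    · exact h _ _
    · exact measurable_const.sub (h _ _)
  have htot : ∑ G, ∫⁻ x : Fin n → X, graphWeight φ x G ∂(Measure.pi fun _ => ξ) = 1 := by
    rw [← lintegral_finsetSum _ fun G _ => hmeas G]
    simp [sum_graphWeight]
  rw [← Finset.sum_filter_add_sum_filter_not _ (fun G => G ∈ F), ← hprob] at htot
  rw [tsub_le_iff_right, ← htot]
  gcongr
  rw [← ENNReal.mul_le_mul_iff_right ht ht']
  refine le_trans ?_ hZ
  rw [Finset.mul_sum]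
  refine (Finset.sum_le_sum fun G hG => ?_).trans
    (Finset.sum_le_sum_of_subset (Finset.subset_univ _))
  rw [← lintegral_const_mul _ (hmeas G)]
  refine lintegral_mono fun x => ?_
  rw [mul_comm]
  gcongr
  exact not_lt.1 fun h => (Finset.mem_filter.1 hG).2 (hF x G h)

variable [MetricSpace X] [BorelSpace X] [SecondCountableTopology X]

/-- The mean weight of a path through distinct vertices: conditionally on the position of its first
vertex, the other positions have a density at most `ν(V)⁻¹` with respect to `ν`. -/
lemma lintegral_pathWeight_comp_le (ν : Measure X) [SigmaFinite ν] {V : Set X}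
    (hV : MeasurableSet V) [IsProbabilityMeasure (ProbabilityTheory.cond ν V)]
    {φ : X → X → ℝ≥0∞} (hφ : Measurable (Function.uncurry φ)) {n r : ℕ} {p : Fin (r + 1) → Fin n}
    (hp : Function.Injective p) :
    ∫⁻ x : Fin n → X, pathWeight φ r (fun i => x (p i))
        ∂(Measure.pi fun _ => ProbabilityTheory.cond ν V) ≤
      (ν V)⁻¹ ^ r * pathIntegral ν φ r := by
  set ξ := ProbabilityTheory.cond ν V with hξ
  rw [(measurePreserving_comp_injective ξ hp).lintegral_comp (measurable_pathWeight hφ r),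
    ← (measurePreserving_piFinSuccAbove (fun _ : Fin (r + 1) => ξ) 0).symm.lintegral_comp
      (measurable_pathWeight hφ r),
    lintegral_prod (fun a : X × (Fin r → X) =>
      pathWeight φ r ((MeasurableEquiv.piFinSuccAbove (fun _ => X) 0).symm a))
      ((measurable_pathWeight hφ r).comp (MeasurableEquiv.measurable _)).aemeasurable]
  calc _ ≤ ∫⁻ _ : X, (ν V)⁻¹ ^ r * pathIntegral ν φ r ∂ξ := by
        refine lintegral_mono fun x₀ => ?_
        rw [hξ, pi_cond_eq ν hV r, lintegral_smul_measure, smul_eq_mul]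
        gcongr
        refine (lintegral_mono' Measure.restrict_le_self le_rfl).trans
          (le_trans (le_of_eq ?_) (lintegral_pathWeight_le ν φ r x₀))
        refine lintegral_congr fun y => ?_
        simp [MeasurableEquiv.piFinSuccAbove, Fin.insertNthEquiv]
    _ = _ := by simp

/-- The generating function, at `b`, of the number of admissible paths by length. An injective path
in `Fin n` has length less than `n`. -/
def pathGenerating {n : ℕ} (b : ℝ≥0∞) (x : Fin n → X) (G : SimpleGraph (Fin n)) : ℝ≥0∞ :=
  ∑ r ∈ Finset.range n, b ^ r *
    (Finset.univ.filter fun p : Fin (r + 1) → Fin n => IsAdmissible G (distKey x) r p).card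

/-- The expectation of the generating function of the admissible paths. -/
lemma sum_lintegral_pathGenerating_le (ν : Measure X) [SigmaFinite ν] {V : Set X}
    (hV : MeasurableSet V) [IsProbabilityMeasure (ProbabilityTheory.cond ν V)]
    {φ : X → X → ℝ≥0∞} (hφ : Measurable (Function.uncurry φ)) (hsymm : ∀ x y, φ x y = φ y x)
    (n : ℕ) (b : ℝ≥0∞) :
    ∑ G, ∫⁻ x : Fin n → X, graphWeight φ x G * pathGenerating b x G
        ∂(Measure.pi fun _ => ProbabilityTheory.cond ν V) ≤
      n * ∑' r, pathIntegral ν φ r * (n * b * (ν V)⁻¹) ^ r := by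
  set ξ := ProbabilityTheory.cond ν V with hξ
  -- The lower Lebesgue integral is superadditive, so that the statistic, which depends on the order
  -- of distances, need not be shown to be measurable.
  have hsum : ∀ (s : Finset (SimpleGraph (Fin n))) (f : SimpleGraph (Fin n) → (Fin n → X) → ℝ≥0∞),
      ∑ G ∈ s, ∫⁻ x, f G x ∂(Measure.pi fun _ => ξ) ≤
        ∫⁻ x, ∑ G ∈ s, f G x ∂(Measure.pi fun _ => ξ) := by
    intro s f
    induction s using Finset.induction_on with
    | empty => simp
    | insert G s hG ih =>
      simp only [Finset.sum_insert hG]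
      exact (add_le_add_right ih _).trans (le_lintegral_add _ _)
  have hpoint : ∀ x : Fin n → X, ∑ G, graphWeight φ x G * pathGenerating b x G ≤
      ∑ r ∈ Finset.range n, ∑ p ∈ Finset.univ.filter
        (fun p : Fin (r + 1) → Fin n => Function.Injective p),
          b ^ r * pathWeight φ r fun i => x (p i) := by
    intro x
    simp only [pathGenerating, Finset.mul_sum]
    rw [Finset.sum_comm]
    refine Finset.sum_le_sum fun r _ => ?_
    calc _ = ∑ G, ∑ p : Fin (r + 1) → Fin n,
          if IsAdmissible G (distKey x) r p then b ^ r * graphWeight φ x G else 0 := by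
          refine Finset.sum_congr rfl fun G _ => ?_
          rw [← Finset.sum_filter, Finset.sum_const, nsmul_eq_mul]
          ring
      _ = ∑ p : Fin (r + 1) → Fin n, b ^ r *
          ∑ G ∈ Finset.univ.filter (fun G => IsAdmissible G (distKey x) r p),
            graphWeight φ x G := by
          rw [Finset.sum_comm]
          refine Finset.sum_congr rfl fun p _ => ?_
          rw [← Finset.sum_filter, Finset.mul_sum]
      _ = ∑ p ∈ Finset.univ.filter (fun p : Fin (r + 1) → Fin n => Function.Injective p), b ^ r *
          ∑ G ∈ Finset.univ.filter (fun G => IsAdmissible G (distKey x) r p),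
            graphWeight φ x G := by
          symm
          refine Finset.sum_subset (Finset.subset_univ _) fun p _ hp => ?_
          rw [Finset.filter_false_of_mem, Finset.sum_empty, mul_zero]
          exact fun G _ hG => hp (Finset.mem_filter.2 ⟨Finset.mem_univ _, hG.1⟩)
      _ ≤ _ := by
          refine Finset.sum_le_sum fun p hp => ?_
          gcongr
          exact sum_graphWeight_isAdmissible_le hsymm x r p (Finset.mem_filter.1 hp).2
  have hmeas : ∀ (r : ℕ) (p : Fin (r + 1) → Fin n),
      Measurable fun x : Fin n → X => pathWeight φ r fun i => x (p i) := fun r p =>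
    (measurable_pathWeight hφ r).comp (measurable_pi_iff.2 fun i => measurable_pi_apply _)
  calc _ ≤ _ := hsum _ _
    _ ≤ _ := lintegral_mono hpoint
    _ = ∑ r ∈ Finset.range n, ∑ p ∈ Finset.univ.filter
        (fun p : Fin (r + 1) → Fin n => Function.Injective p), b ^ r *
          ∫⁻ x : Fin n → X, pathWeight φ r (fun i => x (p i)) ∂(Measure.pi fun _ => ξ) := by
        rw [lintegral_finsetSum _ fun r _ => Finset.measurable_fun_sum _ fun p _ =>
          (hmeas r p).const_mul _]
        refine Finset.sum_congr rfl fun r _ => ?_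
        rw [lintegral_finsetSum _ fun p _ => (hmeas r p).const_mul _]
        exact Finset.sum_congr rfl fun p _ => lintegral_const_mul _ (hmeas r p)
    _ ≤ ∑ r ∈ Finset.range n, ∑ p ∈ Finset.univ.filter
        (fun p : Fin (r + 1) → Fin n => Function.Injective p), b ^ r *
          ((ν V)⁻¹ ^ r * pathIntegral ν φ r) := by
        gcongr with r hr p hp
        exact lintegral_pathWeight_comp_le ν hV hφ (Finset.mem_filter.1 hp).2
    _ ≤ ∑ r ∈ Finset.range n, n * (pathIntegral ν φ r * (n * b * (ν V)⁻¹) ^ r) := by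
        refine Finset.sum_le_sum fun r _ => ?_
        rw [Finset.sum_const, nsmul_eq_mul]
        have hcard : (((Finset.univ.filter
            (fun p : Fin (r + 1) → Fin n => Function.Injective p)).card : ℕ) : ℝ≥0∞) ≤
            (n : ℝ≥0∞) ^ (r + 1) := by
          refine le_trans (Nat.cast_le.2 (Finset.card_le_univ _)) ?_
          simp
        refine (mul_le_mul_left hcard _).trans (le_of_eq ?_)
        ring
    _ ≤ _ := by
        rw [← Finset.mul_sum]
        gcongr
        exact ENNReal.sum_le_tsum _

end Expectation

/-! ### Spatial mixing with high probability -/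

section Mixing

open scoped Classical

/-- The decay of the influence of boundary conditions in a single graph on `n` vertices. -/
def DecayOfInfluence {n : ℕ} (G : SimpleGraph (Fin n)) (z α β a : ℝ) : Prop :=
  ∀ (v : Fin n) (S : Set (Fin n)), v ∉ S → ∀ τ τ' : S → Bool,
    Feasible G z S τ → Feasible G z S τ' →
    ∀ s : ℕ, a * Real.log n ≤ s → DifferOnlyFrom G v S τ τ' s →
      |occupationRatio G z S τ v - occupationRatio G z S τ' v| ≤ α * Real.exp (-β * s)

lemma strongSpatialMixing_of_decayOfInfluence {n : ℕ} {F : Set (SimpleGraph (Fin n))}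
    {z α β a : ℝ} (hα : 0 ≤ α) (hβ : 0 < β) (ha : 0 ≤ a)
    (hF : ∀ G ∈ F, DecayOfInfluence G z α β a) :
    StrongSpatialMixing z (Sigma.mk n '' F) (Real.exp (-β)) := by
  refine ⟨(Real.exp_pos _).le, Real.exp_lt_one_iff.2 (neg_neg_of_pos hβ), α, a, hα, ha, ?_⟩
  rintro _ _ ⟨G, hG, ⟨⟩⟩ v S hv τ τ' hτ hτ' s hs hd
  rw [← Real.exp_nat_mul, mul_comm (s : ℝ)]
  exact hF G hG v S hv τ τ' hτ hτ' s hs hd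

/-- Spatial mixing of a graph with few admissible paths. The hypothesis `hcount` loses a factor
`n ^ 2`, which is absorbed by half of the decay `q ^ s` as soon as `s ≥ 4 log n / log (1 / q)`. -/
lemma decayOfInfluence_of_card_le {K : Type*} [LinearOrder K] {n : ℕ} {G : SimpleGraph (Fin n)}
    {key : Fin n → Fin n → K} (hkey : ∀ v, Function.Injective (key v)) {z lam b M q : ℝ}
    (hn : 1 ≤ n) (hz : 0 ≤ z) (hzl : z ≤ lam) (hb : 0 < b) (hM : 0 ≤ M) (hq : 0 < q) (hq1 : q < 1)
    (hzb : z / Real.exp 1 ≤ q * b)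
    (hcount : ∀ r, ((Finset.univ.filter fun p : Fin (r + 1) → Fin n =>
      IsAdmissible G key r p).card : ℝ) * b ^ r ≤ M * n ^ 2) :
    DecayOfInfluence G z ((lam + (1 + lam) * (2 * √lam) * √(lam * M)) * Real.exp (-Real.log q))
      (-Real.log q / 4) (4 / (-Real.log q)) := by
  intro v S hv τ τ' hτ hτ' s hs hd
  have hlam : 0 ≤ lam := hz.trans hzl
  have hn0 : (0 : ℝ) < n := by exact_mod_cast hn
  set L := -Real.log q with hL
  have hLpos : 0 < L := by rw [hL]; exact neg_pos.2 (Real.log_neg hq hq1)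
  have hqL : q = Real.exp (-L) := by rw [hL, neg_neg, Real.exp_log hq]
  rw [mul_assoc, ← Real.exp_add]
  rcases lt_or_ge s 2 with hs2 | hs2
  -- For `s < 2` the boundary conditions may differ next to `v`, and only `0 ≤ R ≤ z` is used.
  · have h1 := occupationRatio_mem_Icc hz hv hτ
    have h2 := occupationRatio_mem_Icc hz hv hτ'
    have h3 : |occupationRatio G z S τ v - occupationRatio G z S τ' v| ≤ lam := by
      rw [abs_le]
      constructor <;> linarith [h1.1, h1.2, h2.1, h2.2]
    have hs' : (s : ℝ) ≤ 2 := by exact_mod_cast hs2.le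
    have h4 : 1 ≤ Real.exp (L + -(L / 4) * s) := Real.one_le_exp (by nlinarith)
    have h5 : 0 ≤ (1 + lam) * (2 * √lam) * √(lam * M) := by positivity
    nlinarith
  · obtain ⟨r, hr⟩ := Nat.exists_eq_add_of_le' hs2
    have hwalk : (walkCount G key r (freePart G S τ v) v : ℝ) * b ^ r ≤ M * n ^ 2 := by
      refine le_trans ?_ (hcount r)
      gcongr
      refine (walkCount_le_card_univ key r _ v (by simp [freePart])).trans
        (Finset.card_le_card fun p hp => ?_)
      simp only [Finset.mem_filter, Finset.mem_univ, true_and] at hp ⊢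
      exact hp.2
    have hsq : (n : ℝ) ^ 2 ≤ Real.exp (L * s / 2) := by
      rw [div_mul_eq_mul_div, div_le_iff₀ hLpos] at hs
      rw [← Real.exp_log (pow_pos hn0 2), Real.log_pow]
      refine Real.exp_le_exp.2 ?_
      push_cast
      linarith
    have hrs : (s : ℝ) = r + 2 := by exact_mod_cast hr
    have hmain : (z / Real.exp 1) ^ r * z * walkCount G key r (freePart G S τ v) v ≤
        (lam * M) * Real.exp (L + -(L / 4) * s) ^ 2 := by
      calc (z / Real.exp 1) ^ r * z * walkCount G key r (freePart G S τ v) v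
          ≤ (q * b) ^ r * lam * walkCount G key r (freePart G S τ v) v := by gcongr
        _ = lam * (walkCount G key r (freePart G S τ v) v * b ^ r) * q ^ r := by ring
        _ ≤ lam * (M * n ^ 2) * q ^ r := by gcongr
        _ ≤ lam * (M * Real.exp (L * s / 2)) * Real.exp (-L) ^ r := by rw [← hqL]; gcongr
        _ = (lam * M) * (Real.exp (L * s / 2) * Real.exp (-L) ^ r) := by ring
        _ = _ := by
          rw [← Real.exp_nat_mul, ← Real.exp_nat_mul, ← Real.exp_add, hrs]
          congr 2
          push_cast
          ring
    calc _ ≤ (1 + z) * (2 * √z) *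
          √((z / Real.exp 1) ^ r * z * walkCount G key r (freePart G S τ v) v) :=
          abs_occupationRatio_sub_le hz hkey hv hτ hτ' hr.symm hd
      _ ≤ (1 + lam) * (2 * √lam) * √((lam * M) * Real.exp (L + -(L / 4) * s) ^ 2) := by
          gcongr
      _ = (1 + lam) * (2 * √lam) * √(lam * M) * Real.exp (L + -(L / 4) * s) := by
          rw [Real.sqrt_mul (by positivity), Real.sqrt_sq (Real.exp_pos _).le, ← mul_assoc]
      _ ≤ _ := by
          gcongr
          linarith

/-- A bound on the generating function bounds the number of admissible paths of each length. -/
lemma card_isAdmissible_mul_pow_le {X : Type*} [MetricSpace X] {n : ℕ} {b M : ℝ≥0}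
    {x : Fin n → X} {G : SimpleGraph (Fin n)} (h : pathGenerating (b : ℝ≥0∞) x G ≤ M) (r : ℕ) :
    ((Finset.univ.filter fun p : Fin (r + 1) → Fin n =>
      IsAdmissible G (distKey x) r p).card : ℝ) * (b : ℝ) ^ r ≤ M := by
  rcases lt_or_ge r n with hr | hr
  · have h1 := (Finset.single_le_sum (f := fun r => (b : ℝ≥0∞) ^ r *
      ((Finset.univ.filter fun p : Fin (r + 1) → Fin n =>
        IsAdmissible G (distKey x) r p).card : ℝ≥0∞)) (fun _ _ => zero_le)
        (Finset.mem_range.2 hr)).trans h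
    have h2 : b ^ r * ((Finset.univ.filter fun p : Fin (r + 1) → Fin n =>
        IsAdmissible G (distKey x) r p).card : ℝ≥0) ≤ M := by exact_mod_cast h1
    rw [mul_comm]
    exact_mod_cast h2
  · rw [Finset.filter_false_of_mem]
    · simp
    · rintro p - hp
      have := Fintype.card_le_of_injective p hp.1
      simp at this
      omega

end Mixing

end HardCoreSSM

end

theorem mainTheorem8 {X : Type*} [MetricSpace X] [CompleteSpace X]
    [TopologicalSpace.SeparableSpace X] [MeasurableSpace X] [BorelSpace X]
    (ν : Measure X) [IsLocallyFiniteMeasure ν]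
    (hν : ∀ A : Set X, Bornology.IsBounded A → MeasurableSet A → ν A < ∞)
    (φ : X → X → ℝ≥0∞) (hφ_meas : Measurable (Function.uncurry φ))
    (hφ_symm : ∀ x y, φ x y = φ y x)
    (hC : HardCoreSSM.temperedness ν φ < ∞) (hΔ : 0 < HardCoreSSM.pwcc ν φ)
    (lam : ℝ≥0)
    (hlam : (lam : ℝ≥0∞) < ENNReal.ofReal (Real.exp 1) / HardCoreSSM.pwcc ν φ) :
    ∃ (n₀ : Set X → ℝ) (c₁ c₂ α β a : ℝ),
      0 < c₁ ∧ 0 < c₂ ∧ 0 ≤ α ∧ 0 < β ∧ 0 ≤ a ∧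
      ∀ V : Set X, Bornology.IsBounded V → MeasurableSet V → 0 < ν V →
        c₁ * (ν V).toReal ≤ n₀ V ∧ n₀ V ≤ c₂ * (ν V).toReal ∧
        ∀ n : ℕ, 1 ≤ n → n₀ V ≤ n →
          ∃ F : Set (SimpleGraph (Fin n)),
            ENNReal.ofReal (1 - 1 / (n : ℝ)) ≤ HardCoreSSM.randomGraphProb ν V φ n F ∧
            (∀ G ∈ F, ∀ (v : Fin n) (S : Set (Fin n)), v ∉ S → ∀ τ τ' : S → Bool,
              HardCoreSSM.Feasible G (lam * (ν V).toReal / n) S τ →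
              HardCoreSSM.Feasible G (lam * (ν V).toReal / n) S τ' →
              ∀ s : ℕ, a * Real.log n ≤ s → HardCoreSSM.DifferOnlyFrom G v S τ τ' s →
                |HardCoreSSM.occupationRatio G (lam * (ν V).toReal / n) S τ v -
                    HardCoreSSM.occupationRatio G (lam * (ν V).toReal / n) S τ' v|
                  ≤ α * Real.exp (-β * s)) ∧
            HardCoreSSM.StrongSpatialMixing (lam * (ν V).toReal / n) (Sigma.mk n '' F)
              (Real.exp (-β)) := by
  have : SecondCountableTopology X := UniformSpace.secondCountable_of_separable X
  obtain ⟨D, hD, hlamD, hsum⟩ :=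
    HardCoreSSM.exists_tsum_pathIntegral_ne_top ν hφ_meas hC lam hlam
  set M := ∑' k, HardCoreSSM.pathIntegral ν φ k * ((D : ℝ≥0∞)⁻¹) ^ k with hM
  have hM1 : 1 ≤ M := by
    refine le_trans (le_of_eq ?_) (ENNReal.le_tsum 0)
    simp [HardCoreSSM.pathIntegral]
  clear_value M
  lift M to ℝ≥0 using hsum
  -- The rate `q` has to dominate `λ D / e < 1`; it is kept positive for the sake of its logarithm.
  obtain ⟨q, hq, hq1, hlamq⟩ : ∃ q : ℝ, 0 < q ∧ q < 1 ∧ lam * D / Real.exp 1 ≤ q :=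
    ⟨max (lam * D / Real.exp 1) (1 / 2), by positivity,
      max_lt ((div_lt_one (Real.exp_pos 1)).2 hlamD) (by norm_num), le_max_left _ _⟩
  have hL : 0 < -Real.log q := neg_pos.2 (Real.log_neg hq hq1)
  refine ⟨fun V => (ν V).toReal, 1, 1,
    (lam + (1 + lam) * (2 * √lam) * √(lam * M)) * Real.exp (-Real.log q), -Real.log q / 4,
    4 / (-Real.log q), one_pos, one_pos, by positivity, by positivity, by positivity, ?_⟩
  intro V hVb hVm hVpos
  refine ⟨(one_mul _).le, (one_mul _).ge, fun n hn hVn => ?_⟩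
  have hVfin : ν V ≠ ∞ := (hν V hVb hVm).ne
  have : IsProbabilityMeasure (ProbabilityTheory.cond ν V) :=
    ProbabilityTheory.cond_isProbabilityMeasure_of_finite hVpos.ne' hVfin
  have hn0 : (n : ℝ≥0) ≠ 0 := by exact_mod_cast (by omega : n ≠ 0)
  obtain ⟨m, hm⟩ : ∃ m : ℝ≥0, ν V = m := ⟨_, (ENNReal.coe_toNNReal hVfin).symm⟩
  have hm0 : 0 < m := by rw [hm] at hVpos; exact_mod_cast hVpos
  simp only [hm, ENNReal.coe_toReal] at hVn ⊢
  set F : Set (SimpleGraph (Fin n)) :=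
    {G | HardCoreSSM.DecayOfInfluence G (lam * m / n)
      ((lam + (1 + lam) * (2 * √lam) * √(lam * M)) * Real.exp (-Real.log q))
      (-Real.log q / 4) (4 / (-Real.log q))}
  refine ⟨F, ?_, fun G hG => hG, HardCoreSSM.strongSpatialMixing_of_decayOfInfluence
    (by positivity) (by positivity) (by positivity) fun G hG => hG⟩
  -- The statistic is the generating function at `b = ν(V) / (n D)`, whose mean is at most `n M`.
  set b : ℝ≥0 := m / (n * D) with hb
  have hb0 : 0 < b := by positivity
  have hnbm : (n : ℝ≥0∞) * b * (ν V)⁻¹ = (D : ℝ≥0∞)⁻¹ := by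
    rw [hm, ← ENNReal.coe_inv hm0.ne', ← ENNReal.coe_inv hD.ne', ← ENNReal.coe_natCast]
    norm_cast
    rw [hb]
    field_simp
  have hmarkov := HardCoreSSM.one_sub_le_randomGraphProb ν (V := V) hφ_meas F
    (HardCoreSSM.pathGenerating (b : ℝ≥0∞)) (t := ((M * n ^ 2 : ℝ≥0) : ℝ≥0∞))
    (ε := (((n : ℝ≥0)⁻¹ : ℝ≥0) : ℝ≥0∞)) ?_ ENNReal.coe_ne_top ?_ ?_
  · refine le_trans (le_of_eq ?_) hmarkov
    rw [ENNReal.ofReal_sub _ (by positivity), ENNReal.ofReal_one, one_div,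
      ← NNReal.coe_natCast n, ← NNReal.coe_inv, ENNReal.ofReal_coe_nnreal]
  · have : (1 : ℝ≥0) ≤ M := by exact_mod_cast hM1
    have : 0 < M := lt_of_lt_of_le one_pos this
    exact_mod_cast (by positivity : M * (n : ℝ≥0) ^ 2 ≠ 0)
  · intro x G hZ
    refine HardCoreSSM.decayOfInfluence_of_card_le (HardCoreSSM.distKey_injective x) (b := b)
      hn (by positivity) ?_ (by exact_mod_cast hb0) M.coe_nonneg hq hq1 ?_ (fun r => ?_)
    · rw [mul_div_assoc]
      exact mul_le_of_le_one_right lam.coe_nonneg (div_le_one_of_le₀ hVn n.cast_nonneg)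
    · have hb' : (b : ℝ) = m / (n * D) := by rw [hb]; push_cast; rfl
      have hn' : (0 : ℝ) < n := by exact_mod_cast hn
      have hD' : (0 : ℝ) < D := hD
      calc (lam * m / n : ℝ) / Real.exp 1 = (lam * D / Real.exp 1) * b := by
            rw [hb']; field_simp
        _ ≤ _ := by gcongr
    · have := HardCoreSSM.card_isAdmissible_mul_pow_le hZ.le r
      push_cast at this
      exact this
  · refine (HardCoreSSM.sum_lintegral_pathGenerating_le ν hVm hφ_meas hφ_symm n b).trans
      (le_of_eq ?_)
    rw [hnbm, ← hM, ← ENNReal.coe_mul, ← ENNReal.coe_natCast n, ← ENNReal.coe_mul]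
    congr 1
    field_simp
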